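/- All graphs are finite, simple, undirected and connected; $d_G$ is the graph distance, $I(a,b)=\{t: d_G(a,t)+d_G(t,b)=d_G(a,b)\}$, and $\mathrm{Pr}(u,A)$ is the set of vertices of $A$ at minimum distance from $u$. Let $G=(V,E)$ be a $K_4$-free bridged graph (every isometric cycle of $G$ has length $3$), and let $z\in V$. Let $N[z]$ be the closed neighborhood of $z$, and let the star $\mathrm{St}(z)$ consist of $N[z]$ and all vertices outside $N[z]$ having two distinct neighbors in $N[z]$. For $x\in N[z]$ the fiber $F(x)$ is the set of vertices $u$ with $\mathrm{Pr}(u,N[z])=\{x\}$; for $x\in \mathrm{St}(z)\setminus N[z]$ the fiber $F(x)$ is the set of vertices $u$ such that $\mathrm{Pr}(u,N[z])$ consists of two adjacent vertices $a,b$, both adjacent to $x$, with $d_G(u,x)=d_G(u,a)-1=d_G(u,b)-1$. The fiber $F(x)$ is a panel if $x\sim z$ and a cone if $x \in \mathrm{St}(z)$ and $d_G(x,z)=2$. Two fibers $F(x),F(y)$ are $k$-neighboring if $x$ and $y$ are at distance $k$ in the subgraph induced by $\mathrm{St}(z)\setminus\{z\}$. The total boundary $\partial^*F(x)$ is the set of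 vertices of $F(x)$ having a neighbor in another fiber. An entrance of a vertex $u$ on $T=\partial^*F(w)$ is a vertex of $\mathrm{Pr}(u,T)$ closest to $w$. Let $F(x)$ and $F(y)$ be two 2-neighboring cones, let $u\in F(x)$ and $v\in F(y)$, let $F(w)$ be a panel 1-neighboring both $F(x)$ and $F(y)$, and set $T:=\partial^*F(w)$. Let $u'$ and $v'$ be the entrances of $u$ and $v$ on $T$. Then some shortest $(u,v)$-path of $G$ contains a vertex of $F(w)$, and $$d_G(u,v)\le d_G(u,u')+d_T(u',v')+d_G(v',v)\le 4\,d_G(u,v).$$ Both inequalities hold whether $d_T$ denotes the distance in the induced subgraph $G[T]$ or the distance in the starshaped tree on $T$ rooted at $w$, i.e. in the union of the branches $G[I(w,s)]$, $s\in T$ (the latter distance being at least the former). -/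

import Mathlib

namespace BridgedStar

variable {V : Type*}

/-- A subgraph `H` of `G` is isometric if it is connected and its own distances are those of `G`. -/
def IsIsometric (G : SimpleGraph V) (H : G.Subgraph) : Prop :=
  H.Connected ∧ ∀ a b : H.verts, H.coe.dist a b = G.dist (a : V) (b : V)

/-- `G` is bridged if every isometric cycle of `G` has length 3. -/
def IsBridged (G : SimpleGraph V) : Prop :=
  ∀ (a : V) (p : G.Walk a a), p.IsCycle → IsIsometric G p.toSubgraph → p.length = 3

/-- The interval `I(u,v)`. -/
def interval (G : SimpleGraph V) (u v : V) : Set V :=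
  {t | G.dist u t + G.dist t v = G.dist u v}

/-- The metric projection of `u` on `A`. -/
def metricProj (G : SimpleGraph V) (u : V) (A : Set V) : Set V :=
  {t | t ∈ A ∧ ∀ a ∈ A, G.dist u t ≤ G.dist u a}

/-- The closed neighborhood `N[z]`. -/
def closedNbhd (G : SimpleGraph V) (z : V) : Set V :=
  {t | t = z ∨ G.Adj z t}

/-- The star `St(z)`: `N[z]` together with all vertices outside `N[z]` having two distinct
neighbors in `N[z]`. -/
def star (G : SimpleGraph V) (z : V) : Set V :=
  {t | t ∈ closedNbhd G z ∨
    (t ∉ closedNbhd G z ∧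
      ∃ a ∈ closedNbhd G z, ∃ b ∈ closedNbhd G z, a ≠ b ∧ G.Adj t a ∧ G.Adj t b)}

/-- The fiber `F(x)` of `x ∈ St(z)` with respect to `St(z)`. If `x ∈ N[z]`, it consists of the
vertices having `x` as their unique projection on `N[z]`. Otherwise it consists of the vertices `u`
whose projection on `N[z]` is formed by two adjacent vertices `a, b` such that `x` is adjacent to
`a, b` and is one step closer to `u` than `a` and `b`. -/
def fiber (G : SimpleGraph V) (z x : V) : Set V :=
  {u | (x ∈ closedNbhd G z ∧ metricProj G u (closedNbhd G z) = {x}) ∨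
    (x ∉ closedNbhd G z ∧ ∃ a b : V, G.Adj a b ∧ metricProj G u (closedNbhd G z) = {a, b} ∧
      G.Adj x a ∧ G.Adj x b ∧
      G.dist u x + 1 = G.dist u a ∧ G.dist u x + 1 = G.dist u b)}

/-- `F(x)` is a panel with respect to `St(z)`. -/
def IsPanel (G : SimpleGraph V) (z x : V) : Prop :=
  x ∈ star G z ∧ G.Adj x z

/-- `F(x)` is a cone with respect to `St(z)`. -/
def IsCone (G : SimpleGraph V) (z x : V) : Prop :=
  x ∈ star G z ∧ G.dist x z = 2

/-- The subgraph `G[A]` induced by `A`, viewed as a graph on `V` in which the vertices outside `A`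
are isolated. Its distances between vertices of `A` are those of `G[A]`. -/
def inducedOn (G : SimpleGraph V) (A : Set V) : SimpleGraph V :=
  (G.induce A).spanningCoe

/-- The fibers `F(x)` and `F(y)` are `k`-neighboring: `x` and `y` are at distance `k` in the
subgraph induced by `St(z) \ {z}`. -/
def Neighboring (G : SimpleGraph V) (z : V) (k : ℕ) (x y : V) : Prop :=
  x ∈ star G z \ {z} ∧ y ∈ star G z \ {z} ∧
    (inducedOn G (star G z \ {z})).edist x y = k

/-- The boundary of `F(x)` with respect to `F(y)`. -/
def boundary (G : SimpleGraph V) (z x y : V) : Set V :=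
  {u | u ∈ fiber G z x ∧ ∃ t ∈ fiber G z y, G.Adj u t}

/-- The total boundary `∂*F(x)`: the union of the boundaries of `F(x)` with respect to the other
fibers. -/
def totalBoundary (G : SimpleGraph V) (z x : V) : Set V :=
  {u | ∃ y ∈ star G z, y ≠ x ∧ u ∈ boundary G z x y}

/-- `u'` is an entrance of `u` on the total boundary `T` of `F(w)`: among the vertices of the metric
projection of `u` on `T`, it is one closest to `w`. -/
def IsEntrance (G : SimpleGraph V) (z w u u' : V) : Prop :=
  u' ∈ metricProj G u (totalBoundary G z w) ∧
    ∀ t ∈ metricProj G u (totalBoundary G z w), G.dist u' w ≤ G.dist t w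

/-- The graph of the starshaped tree on `T` rooted at `w`: the union, over `s ∈ T`, of the
branches `G[I(w,s)]`. It need not contain all edges of `G` between vertices of `T`. -/
def branchGraph (G : SimpleGraph V) (w : V) (T : Set V) : SimpleGraph V :=
  ⨆ s ∈ T, inducedOn G (interval G w s)

end BridgedStar

/-!
A bridged graph satisfies two local conditions: the neighbors of `u` on geodesics to `p` are pairwise
adjacent, and the ends of an edge equidistant from `p` have a common neighbor closer to `p`
(`adj_of_mem_interval`, `triangle_condition`). They yield the forms of convexity of balls used below
(`dist_le_of_increase`, `dist_le_of_no_common_neighbor`, `edge_ball_convex`).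

Fibers are described by gates, the gates of `u` being the neighbors of `z` in `I(z,u)`. Since `G` has
no `K₄`, every vertex other than `z` has one gate (panels) or two (cones), and the gate sets of
adjacent vertices, not both neighbors of `z`, are nested (`isGate_nested`). Hence, along a geodesic
from `F(x)` to `F(y)` that avoids `F(w)`, the gate adjacent to `w` cannot change; if the gates of the
two cones other than `w` differ, this is absurd, and if they coincide, `w` itself lies on a geodesic
(`exists_inPanel_mem_interval`).

A boundary vertex of `F(w)` other than `w` has a unique neighbor closer to `w`, again on the boundary
(`OnBoundary.exists_unique_lower`), so that the total boundary `T` is starshaped. For `u` in `F(x)`,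
the vertices of `F(w)` in `I(w,u)` form a path of boundary vertices starting at `w`, and the entrance
`u'` is its other end (`InCone.entrance`). Let `g` be the last common vertex of the branches from `w`
to `u'` and to `v'`. No neighbor of `g` lies in both `I(g,u)` and `I(g,v)`, hence `d(u,v)` is at least
`d(g,u) = d(g,u') + d(u',u)` and at least `d(g,v) = d(g,v') + d(v',v)`. As `g` connects `u'` to `v'`
in the starshaped tree, the sum to be estimated is at most `2 d(u,v)`
(`exists_branching_vertex`), which is better than required.
-/

namespace BridgedStar

variable {V : Type*} {G : SimpleGraph V}

/-! ### Shortcuts of closed sequences -/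

theorem dist_le_add_one_of_adj (hc : G.Connected) (p : V) {a b : V} (h : G.Adj a b) :
    G.dist p b ≤ G.dist p a + 1 := by
  have h1 := hc.dist_triangle (u := p) (v := a) (w := b)
  rwa [SimpleGraph.dist_eq_one_iff_adj.mpr h] at h1

theorem exists_adj_dist_add_one (hc : G.Connected) (p : V) {u : V} (h : 0 < G.dist p u) :
    ∃ a, G.Adj u a ∧ G.dist p a + 1 = G.dist p u := by
  obtain ⟨q, hq⟩ := hc.exists_walk_length_eq_dist u p
  cases q with
  | nil => simp at h
  | @cons _ a _ hadj q' =>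
    refine ⟨a, hadj, ?_⟩
    have h1 := SimpleGraph.dist_le q'
    have h2 := dist_le_add_one_of_adj hc p hadj.symm
    rw [SimpleGraph.Walk.length_cons] at hq
    rw [G.dist_comm (u := a)] at h1
    rw [G.dist_comm (u := u)] at hq
    omega

/-- In a bridged graph every closed sequence `f 0, …, f (L - 1)` of consecutively adjacent vertices
with `L ≥ 4` has a shortcut: two of its vertices are closer in `G` than along the sequence. -/
theorem exists_shortcut (hbr : IsBridged G) (f : ℕ → V) (L : ℕ) (hL : 4 ≤ L)
    (hadj : ∀ i, i + 1 < L → G.Adj (f i) (f (i + 1))) (hlast : G.Adj (f (L - 1)) (f 0)) :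
    ∃ i j, i < j ∧ j < L ∧ G.dist (f i) (f j) < j - i ∧ G.dist (f i) (f j) + (j - i) < L := by
  by_contra hno
  push Not at hno
  have hinj : ∀ i j, i < L → j < L → f i = f j → i = j := by
    intro i j hi hj hij
    rcases lt_trichotomy i j with h | h | h
    · have := hno i j h hj
      rw [hij, SimpleGraph.dist_self] at this
      omega
    · exact h
    · have := hno j i h hi
      rw [hij, SimpleGraph.dist_self] at this
      omega
  have hwalk : ∀ n, n < L → ∃ q : G.Walk (f 0) (f n), q.length = n ∧
      q.support = (List.range (n + 1)).map f ∧
      q.edges = (List.range n).map (fun i => s(f i, f (i + 1))) := by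
    intro n
    induction n with
    | zero => intro _; exact ⟨.nil, by simp⟩
    | succ n ih =>
      intro hn
      obtain ⟨q, h1, h2, h3⟩ := ih (by omega)
      refine ⟨q.concat (hadj n hn), ?_, ?_, ?_⟩
      · rw [SimpleGraph.Walk.length_concat, h1]
      · rw [SimpleGraph.Walk.support_concat, h2, List.range_succ (n := n + 1), List.map_append]
        rfl
      · rw [SimpleGraph.Walk.edges_concat, h3, List.range_succ, List.map_append,
          List.concat_eq_append]
        rfl
  obtain ⟨q, hql, hqs, hqe⟩ := hwalk (L - 1) (by omega)
  have hcyc : (SimpleGraph.Walk.cons hlast q).IsCycle := by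
    rw [SimpleGraph.Walk.cons_isCycle_iff]
    constructor
    · rw [SimpleGraph.Walk.isPath_def, hqs, List.nodup_map_iff_inj_on List.nodup_range]
      intro i hi j hj
      rw [List.mem_range] at hi hj
      exact hinj i j (by omega) (by omega)
    · rw [hqe, List.mem_map]
      rintro ⟨i, hi, he⟩
      rw [List.mem_range] at hi
      rcases Sym2.eq_iff.mp he with ⟨h1, _⟩ | ⟨h1, h2⟩
      · have := hinj i (L - 1) (by omega) (by omega) h1
        omega
      · have := hinj i 0 (by omega) (by omega) h1
        have := hinj (i + 1) (L - 1) (by omega) (by omega) h2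
        omega
  set p := SimpleGraph.Walk.cons hlast q with hp
  have hlen : p.length = L := by
    rw [hp, SimpleGraph.Walk.length_cons, hql]; omega
  set H := p.toSubgraph with hH
  have hHc : H.Connected := p.toSubgraph_connected
  have hmem : ∀ i, i < L → f i ∈ H.verts := by
    intro i hi
    rw [hH, SimpleGraph.Walk.mem_verts_toSubgraph, hp, SimpleGraph.Walk.support_cons,
      List.mem_cons, hqs, List.mem_map]
    exact Or.inr ⟨i, List.mem_range.mpr (by omega), rfl⟩
  have hvert : ∀ a : H.verts, ∃ i, ∃ hi : i < L, a = ⟨f i, hmem i hi⟩ := by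
    rintro ⟨a, ha⟩
    have ha' := ha
    rw [hH, SimpleGraph.Walk.mem_verts_toSubgraph, hp, SimpleGraph.Walk.support_cons,
      List.mem_cons, hqs, List.mem_map] at ha'
    rcases ha' with rfl | ⟨i, hi, rfl⟩
    · exact ⟨L - 1, by omega, rfl⟩
    · rw [List.mem_range] at hi
      exact ⟨i, by omega, rfl⟩
  have hHe : ∀ a b : V, H.Adj a b ↔ s(a, b) ∈ p.edges :=
    fun a b => SimpleGraph.Walk.adj_toSubgraph_iff_mem_edges
  have hHadj : ∀ i, ∀ hi : i + 1 < L,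
      H.coe.dist ⟨f i, hmem i (by omega)⟩ ⟨f (i + 1), hmem (i + 1) hi⟩ = 1 := by
    intro i hi
    rw [SimpleGraph.dist_eq_one_iff_adj, SimpleGraph.Subgraph.coe_adj, hHe, hp,
      SimpleGraph.Walk.edges_cons, List.mem_cons, hqe, List.mem_map]
    exact Or.inr ⟨i, List.mem_range.mpr (by omega), rfl⟩
  have hHlast : H.coe.dist ⟨f (L - 1), hmem (L - 1) (by omega)⟩ ⟨f 0, hmem 0 (by omega)⟩ = 1 := by
    rw [SimpleGraph.dist_eq_one_iff_adj, SimpleGraph.Subgraph.coe_adj, hHe, hp,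
      SimpleGraph.Walk.edges_cons, List.mem_cons]
    exact Or.inl rfl
  have hHt : ∀ a b c : H.verts, H.coe.dist a c ≤ H.coe.dist a b + H.coe.dist b c :=
    fun a b c => hHc.coe.dist_triangle
  have hup : ∀ i n, ∀ hi : i + n < L,
      H.coe.dist ⟨f i, hmem i (by omega)⟩ ⟨f (i + n), hmem (i + n) hi⟩ ≤ n := by
    intro i n
    induction n with
    | zero => intro hi; simp
    | succ n ih =>
      intro hi
      have h1 := ih (by omega)
      have h2 := hHadj (i + n) hi
      have h3 := hHt ⟨f i, hmem i (by omega)⟩ ⟨f (i + n), hmem (i + n) (by omega)⟩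
        ⟨f (i + (n + 1)), hmem (i + (n + 1)) hi⟩
      have h4 : H.coe.dist ⟨f (i + n), hmem (i + n) (by omega)⟩
        ⟨f (i + (n + 1)), hmem (i + (n + 1)) hi⟩ = 1 := h2
      omega
  have hlow : ∀ a b : H.verts, G.dist (a : V) (b : V) ≤ H.coe.dist a b := by
    intro a b
    obtain ⟨r, hr⟩ := hHc.coe.exists_walk_length_eq_dist a b
    have := SimpleGraph.dist_le (r.map H.hom)
    rw [SimpleGraph.Walk.length_map, hr] at this
    exact this
  have hle : ∀ i j, ∀ hi : i < L, ∀ hj : j < L, i ≤ j →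
      H.coe.dist ⟨f i, hmem i hi⟩ ⟨f j, hmem j hj⟩ = G.dist (f i) (f j) := by
    intro i j hi hj hij
    rcases hij.eq_or_lt with rfl | hij
    · simp
    refine le_antisymm ?_ (hlow ⟨f i, hmem i hi⟩ ⟨f j, hmem j hj⟩)
    have h0 := hno i j hij hj
    obtain ⟨n, rfl⟩ := Nat.exists_eq_add_of_lt hij
    have h1 : H.coe.dist ⟨f i, hmem i hi⟩ ⟨f (i + n + 1), hmem (i + n + 1) hj⟩ ≤ n + 1 :=
      hup i (n + 1) hj
    by_cases h : i + n + 1 - i ≤ G.dist (f i) (f (i + n + 1))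
    · omega
    · have h2 := h0 (by omega)
      have h3 : H.coe.dist ⟨f 0, hmem 0 (by omega)⟩ ⟨f i, hmem i hi⟩ ≤ i := by
        have := hup 0 i (by omega)
        simp only [Nat.zero_add] at this
        exact this
      have h4 : H.coe.dist ⟨f (i + n + 1), hmem (i + n + 1) hj⟩
          ⟨f (L - 1), hmem (L - 1) (by omega)⟩ ≤ L - 1 - (i + n + 1) := by
        have := hup (i + n + 1) (L - 1 - (i + n + 1)) (by omega)
        have he : i + n + 1 + (L - 1 - (i + n + 1)) = L - 1 := by omega
        simp only [he] at this
        exact this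
      have h5 := hHt ⟨f (i + n + 1), hmem (i + n + 1) hj⟩ ⟨f (L - 1), hmem (L - 1) (by omega)⟩
        ⟨f 0, hmem 0 (by omega)⟩
      have h6 := hHt ⟨f (i + n + 1), hmem (i + n + 1) hj⟩ ⟨f 0, hmem 0 (by omega)⟩
        ⟨f i, hmem i hi⟩
      rw [SimpleGraph.dist_comm] at h6
      omega
  have hiso : IsIsometric G H := by
    refine ⟨hHc, ?_⟩
    intro a b
    obtain ⟨i, hi, rfl⟩ := hvert a
    obtain ⟨j, hj, rfl⟩ := hvert b
    rcases le_total i j with h | h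
    · exact hle i j hi hj h
    · rw [SimpleGraph.dist_comm, hle j i hj hi h, SimpleGraph.dist_comm]
  have := hbr _ p hcyc hiso
  omega

/-- A 4-cycle of a bridged graph has a diagonal. -/
theorem square_has_diagonal (hc : G.Connected) (hbr : IsBridged G) {a b c d : V}
    (hab : G.Adj a b) (hbc : G.Adj b c) (hcd : G.Adj c d) (hda : G.Adj d a) (hac : a ≠ c)
    (hbd : b ≠ d) : G.Adj a c ∨ G.Adj b d := by
  obtain ⟨f, rfl, rfl, rfl, rfl⟩ : ∃ f : ℕ → V, f 0 = a ∧ f 1 = b ∧ f 2 = c ∧ f 3 = d :=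
    ⟨fun n => match n with | 0 => a | 1 => b | 2 => c | _ => d, rfl, rfl, rfl, rfl⟩
  obtain ⟨i, j, hij, hj, h1, h2⟩ := exists_shortcut hbr f 4 le_rfl
    (by
      intro i hi
      have : i < 3 := by omega
      interval_cases i <;> assumption) hda
  have n1 := mt hc.dist_eq_zero_iff.mp hab.ne
  have n2 := mt hc.dist_eq_zero_iff.mp hbc.ne
  have n3 := mt hc.dist_eq_zero_iff.mp hcd.ne
  have n4 := mt hc.dist_eq_zero_iff.mp hda.symm.ne
  have n5 := mt hc.dist_eq_zero_iff.mp hac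
  have n6 := mt hc.dist_eq_zero_iff.mp hbd
  rw [← SimpleGraph.dist_eq_one_iff_adj, ← SimpleGraph.dist_eq_one_iff_adj]
  rcases (by omega : (i = 0 ∨ i = 1 ∨ i = 2) ∧ (j = 1 ∨ j = 2 ∨ j = 3)) with
    ⟨rfl | rfl | rfl, rfl | rfl | rfl⟩ <;> omega

/-- A bridged graph has no induced 5-cycle. -/
theorem not_induced_pentagon (hc : G.Connected) (hbr : IsBridged G) {a b c d e : V}
    (hab : G.Adj a b) (hbc : G.Adj b c) (hcd : G.Adj c d) (hde : G.Adj d e) (hea : G.Adj e a)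
    (hac : ¬ G.Adj a c) (hbd : ¬ G.Adj b d) (hce : ¬ G.Adj c e) (hda : ¬ G.Adj d a)
    (heb : ¬ G.Adj e b) : False := by
  obtain ⟨f, rfl, rfl, rfl, rfl, rfl⟩ :
      ∃ f : ℕ → V, f 0 = a ∧ f 1 = b ∧ f 2 = c ∧ f 3 = d ∧ f 4 = e :=
    ⟨fun n => match n with | 0 => a | 1 => b | 2 => c | 3 => d | _ => e, rfl, rfl, rfl, rfl, rfl⟩
  obtain ⟨i, j, hij, hj, h1, h2⟩ := exists_shortcut hbr f 5 (by omega)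
    (by
      intro i hi
      have : i < 4 := by omega
      interval_cases i <;> assumption) hea
  have n1 := mt hc.dist_eq_zero_iff.mp hab.ne
  have n2 := mt hc.dist_eq_zero_iff.mp hbc.ne
  have n3 := mt hc.dist_eq_zero_iff.mp hcd.ne
  have n4 := mt hc.dist_eq_zero_iff.mp hde.ne
  have n5 := mt hc.dist_eq_zero_iff.mp hea.symm.ne
  have m1 : ∀ {x y w : V}, G.Adj y w → ¬ G.Adj w x → G.dist x y ≠ 0 := by
    intro x y w h h' h0
    rw [hc.dist_eq_zero_iff] at h0
    exact h' (h0 ▸ h.symm)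
  have q1 := m1 (x := f 0) (y := f 2) hcd hda
  have q2 := m1 (x := f 0) (y := f 3) hcd.symm (fun h => hac h.symm)
  have q3 := m1 (x := f 1) (y := f 3) hde heb
  have q4 := m1 (x := f 1) (y := f 4) hde.symm (fun h => hbd h.symm)
  have q5 := m1 (x := f 2) (y := f 4) hea hac
  rw [← SimpleGraph.dist_eq_one_iff_adj] at hac hbd hce hda heb
  rw [SimpleGraph.dist_comm] at hda heb
  rcases (by omega : (i = 0 ∨ i = 1 ∨ i = 2 ∨ i = 3) ∧ (j = 1 ∨ j = 2 ∨ j = 3 ∨ j = 4)) with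
    ⟨rfl | rfl | rfl | rfl, rfl | rfl | rfl | rfl⟩ <;> omega

/-! ### The interval and triangle conditions -/

/-- The interval condition at distance `k`: the neighbors of `u` in the interval `I(p,u)` are
pairwise adjacent whenever `d(p,u) = k`. -/
def IntervalCondition (G : SimpleGraph V) (k : ℕ) : Prop :=
  ∀ p u a b : V, G.dist p u = k → G.Adj u a → G.Adj u b → G.dist p a + 1 = G.dist p u →
    G.dist p b + 1 = G.dist p u → a = b ∨ G.Adj a b

/-- The triangle condition at distance `k`: the ends of an edge at distance `k > 0` from `p` have a
common neighbor at distance `k - 1` from `p`. -/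
def TriangleCondition (G : SimpleGraph V) (k : ℕ) : Prop :=
  ∀ p a b : V, G.dist p a = k → G.dist p b = k → 0 < k → G.Adj a b →
    ∃ c, G.Adj a c ∧ G.Adj b c ∧ G.dist p c + 1 = k

/-- If the triple `u, p, q` is not the geodesic triple with `u` between `p` and `q`, then the
geodesics from `u` to `p` and to `q` may be chosen to start with equal or adjacent vertices. Only
the interval and triangle conditions for cycles shorter than the bound `L` on the perimeter are
needed, so that the lemma can serve in the induction proving these conditions. -/
theorem exists_adj_of_dist_lt_of_conditions (hc : G.Connected) {L : ℕ}
    (hI : ∀ k, 2 * k < L → IntervalCondition G k)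
    (hT : ∀ k, 2 * k + 1 < L → TriangleCondition G k) (p q : V) :
    ∀ (j : ℕ) (u : V), G.dist q u = j → 0 < G.dist p u → 0 < j → G.dist p q < G.dist p u + j →
      G.dist p u + j + G.dist p q < L →
      ∃ a b, G.Adj u a ∧ G.Adj u b ∧ G.dist p a + 1 = G.dist p u ∧ G.dist q b + 1 = G.dist q u ∧
        (a = b ∨ G.Adj a b) := by
  intro j
  induction j with
  | zero => intro u _ _ h; omega
  | succ j ih =>
    intro u hu hi _ hlt hL
    obtain ⟨r, hur, hr⟩ := exists_adj_dist_add_one hc q (u := u) (by omega)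
    have e1 := dist_le_add_one_of_adj hc p hur
    have e2 := dist_le_add_one_of_adj hc p hur.symm
    have e3 := hc.dist_triangle (u := p) (v := q) (w := r)
    rcases (by omega : G.dist p r + 1 = G.dist p u ∨ G.dist p r = G.dist p u ∨
      G.dist p r = G.dist p u + 1) with h | h | h
    · exact ⟨r, r, hur, hur, h, hr, Or.inl rfl⟩
    · obtain ⟨c, c1, c2, c3⟩ := hT (G.dist p u) (by omega) p u r rfl h hi hur
      exact ⟨c, r, c1, hur, c3, hr, Or.inr c2.symm⟩
    · have hj : 0 < j := by
        rcases Nat.eq_zero_or_pos j with rfl | hj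
        · have : q = r := hc.dist_eq_zero_iff.mp (by omega)
          subst this
          omega
        · exact hj
      obtain ⟨a, b, ha, hb, ha', hb', hab⟩ := ih r (by omega) (by omega) hj (by omega) (by omega)
      have hua := hI (G.dist p r) (by omega) p r u a rfl hur.symm ha (by omega) ha'
      have hub : ¬ (u = b ∨ G.Adj u b) := by
        rintro (rfl | h')
        · omega
        · have := dist_le_add_one_of_adj hc q h'.symm
          omega
      rcases hua with rfl | hua
      · exact absurd hab hub
      rcases hab with rfl | hab
      · exact absurd (Or.inr hua) hub
      have f1 := dist_le_add_one_of_adj hc q hab.symm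
      have f2 := dist_le_add_one_of_adj hc q hua.symm
      obtain ⟨c, c1, c2, c3⟩ := hT (G.dist p u) (by omega) p u a rfl (by omega) hi hua
      exact ⟨c, a, c1, hua, c3, by omega, Or.inr c2.symm⟩

theorem exists_geodesic_sequence (hc : G.Connected) (p : V) :
    ∀ (k : ℕ) (a : V), G.dist p a = k → ∃ f : ℕ → V, f 0 = p ∧ f k = a ∧
      (∀ i, i ≤ k → G.dist p (f i) = i) ∧ ∀ i, i < k → G.Adj (f i) (f (i + 1)) := by
  intro k
  induction k with
  | zero =>
    intro a ha
    have : p = a := hc.dist_eq_zero_iff.mp ha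
    exact ⟨fun _ => p, rfl, this, by simp, by simp⟩
  | succ k ih =>
    intro a ha
    obtain ⟨b, hab, hb⟩ := exists_adj_dist_add_one hc p (u := a) (by omega)
    obtain ⟨f, f0, fk, fd, fa⟩ := ih b (by omega)
    refine ⟨fun i => if i ≤ k then f i else a, by simpa using f0, by simp, ?_, ?_⟩
    · intro i hi
      by_cases h : i ≤ k
      · simpa [h] using fd i h
      · have : i = k + 1 := by omega
        simp [this, ha]
    · intro i hi
      by_cases h : i + 1 ≤ k
      · have h' : i ≤ k := by omega
        simpa [h, h'] using fa i (by omega)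
      · have : i = k := by omega
        subst this
        simpa [fk] using hab.symm

theorem dist_sequence_le (hc : G.Connected) {f : ℕ → V} {k : ℕ}
    (h : ∀ i, i < k → G.Adj (f i) (f (i + 1))) :
    ∀ n i, i + n ≤ k → G.dist (f i) (f (i + n)) ≤ n := by
  intro n
  induction n with
  | zero => intro i _; simp
  | succ n ih =>
    intro i hi
    have := ih i (by omega)
    have := dist_le_add_one_of_adj hc (f i) (h (i + n) (by omega))
    rw [Nat.add_assoc] at this
    omega

/-- Two geodesics `f`, `g` of length `k` from `p`, whose ends agree (`e = 0`) or are adjacent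
(`e = 1`), bound a closed sequence; a shortcut of it joins a vertex of `f` to a vertex of `g`. -/
theorem exists_shortcut_of_geodesics (hc : G.Connected) (hbr : IsBridged G) {p : V} {k e : ℕ}
    {f g : ℕ → V} (he : e = 0 ∧ f k = g k ∨ e = 1 ∧ G.Adj (f k) (g k)) (hL : 4 ≤ 2 * k + e)
    (f0 : f 0 = p) (g0 : g 0 = p)
    (fd : ∀ i, i ≤ k → G.dist p (f i) = i) (gd : ∀ i, i ≤ k → G.dist p (g i) = i)
    (fa : ∀ i, i < k → G.Adj (f i) (f (i + 1))) (ga : ∀ i, i < k → G.Adj (g i) (g (i + 1))) :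
    ∃ i j, 0 < i ∧ 0 < j ∧ i ≤ k ∧ j ≤ k ∧ i + j < 2 * k + e ∧ G.dist (f i) (g j) < i + j ∧
      i + j + G.dist (f i) (g j) < 2 * k + e ∧ (e = 0 → i < k ∧ j < k) := by
  obtain ⟨i, j, hij, hj, h1, h2⟩ := exists_shortcut hbr
    (fun n => if n ≤ k then f n else g (2 * k + e - n)) (2 * k + e) hL
    (by
      intro i hi
      by_cases h : i + 1 ≤ k
      · have h' : i ≤ k := by omega
        simpa [h, h'] using fa i h
      · by_cases h' : i ≤ k
        · have hik : i = k := by omega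
          subst hik
          simp only [le_refl, if_true, h, if_false]
          rcases he with ⟨rfl, he⟩ | ⟨rfl, he⟩
          · have := ga (i - 1) (by omega)
            rw [show i - 1 + 1 = i by omega] at this
            rw [he, show 2 * i + 0 - (i + 1) = i - 1 by omega]
            exact this.symm
          · rwa [show 2 * i + 1 - (i + 1) = i by omega]
        · simp only [h, h', if_false]
          have := ga (2 * k + e - (i + 1)) (by omega)
          rw [show 2 * k + e - (i + 1) + 1 = 2 * k + e - i by omega] at this
          exact this.symm)
    (by
      have h' : ¬ 2 * k + e - 1 ≤ k := by omega
      simp only [h', if_false, Nat.zero_le, if_true]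
      rw [show 2 * k + e - (2 * k + e - 1) = 1 by omega, f0, ← g0]
      exact (ga 0 (by omega)).symm)
  have tri : ∀ a b c : V, G.dist a c ≤ G.dist a b + G.dist b c :=
    fun a b c => hc.dist_triangle
  by_cases hjk : j ≤ k
  · have hik : i ≤ k := by omega
    simp only [hjk, hik, if_true] at h1 h2
    have := tri p (f i) (f j)
    rw [fd i hik, fd j hjk] at this
    omega
  · simp only [hjk, if_false] at h1 h2
    by_cases hik : i ≤ k
    · simp only [hik, if_true] at h1 h2
      have hg := gd (2 * k + e - j) (by omega)
      rcases Nat.eq_zero_or_pos i with rfl | hi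
      · rw [f0] at h1 h2
        omega
      · refine ⟨i, 2 * k + e - j, hi, by omega, hik, by omega, by omega, by omega, by omega, ?_⟩
        rintro rfl
        refine ⟨?_, by omega⟩
        rcases hik.lt_or_eq with h | rfl
        · exact h
        rcases he with ⟨-, he⟩ | ⟨h, -⟩
        · have := tri p (g (2 * i + 0 - j)) (g i)
          rw [hg, gd i le_rfl, G.dist_comm (u := g (2 * i + 0 - j)), ← he] at this
          omega
        · omega
    · simp only [hik, if_false] at h1 h2
      have := tri p (g (2 * k + e - j)) (g (2 * k + e - i))
      rw [gd _ (by omega), gd _ (by omega), G.dist_comm (u := g (2 * k + e - j))] at this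
      omega

/-- Given the two conditions at distance `k - 1`, adjacency is transitive among the neighbors of
`u` in `I(p,u)`, where `d(p,u) = k`: otherwise a path of length 2 in this neighborhood would be
part of an induced 4-cycle or 5-cycle. -/
theorem adj_trans_of_conditions (hc : G.Connected) (hbr : IsBridged G) {k : ℕ} {p u : V}
    (hI : IntervalCondition G (k - 1)) (hT : TriangleCondition G (k - 1)) (hu : G.dist p u = k)
    {a b c : V} (ha : G.Adj u a) (hb : G.Adj u b) (hcu : G.Adj u c) (ha' : G.dist p a + 1 = k)
    (hb' : G.dist p b + 1 = k) (hc' : G.dist p c + 1 = k) (hab : a = b ∨ G.Adj a b)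
    (hbc : b = c ∨ G.Adj b c) : a = c ∨ G.Adj a c := by
  rcases hab with rfl | hab
  · exact hbc
  rcases hbc with rfl | hbc
  · exact Or.inr hab
  by_contra hno
  push Not at hno
  obtain ⟨hne, hac⟩ := hno
  have hk : 0 < k - 1 := by
    rcases Nat.eq_zero_or_pos (k - 1) with h | h
    · exact absurd ((hc.dist_eq_zero_iff.mp (by omega : G.dist p a = 0)).symm.trans
        (hc.dist_eq_zero_iff.mp (by omega : G.dist p c = 0))) hne
    · exact h
  obtain ⟨s, s1, s2, s3⟩ := hT p a b (by omega) (by omega) hk hab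
  obtain ⟨t, t1, t2, t3⟩ := hT p b c (by omega) (by omega) hk hbc
  have far : ∀ {x : V}, G.dist p x + 1 = k - 1 → u ≠ x ∧ ¬ G.Adj u x := by
    intro x hx
    constructor
    · rintro rfl; omega
    · intro h
      have := dist_le_add_one_of_adj hc p h.symm
      omega
  have square : ∀ {x : V}, G.dist p x + 1 = k - 1 → G.Adj a x → G.Adj c x → False := by
    intro x hx h1 h2
    rcases square_has_diagonal hc hbr ha h1 h2.symm hcu.symm (far hx).1 hne with h | h
    · exact (far hx).2 h
    · exact hac h
  rcases hI p b s t (by omega) s2 t1 (by omega) (by omega) with rfl | hst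
  · exact square s3 s1 t2
  · exact not_induced_pentagon hc hbr ha s1 hst t2.symm hcu.symm (far s3).2
      (fun h => square t3 h t2) (fun h => square s3 s1 h.symm) (fun h => (far t3).2 h.symm)
      (fun h => hac h.symm)

/-- Bridged graphs satisfy the interval and triangle conditions, by induction on the length `2k`, resp.
`2k + 1`, of the cycle formed by the geodesics involved. This cycle has a shortcut, and
`exists_adj_of_dist_lt_of_conditions`, applied to the ends of the shortcut, provides the vertices
to which the conditions at smaller distances apply. -/
theorem conditions_below (hc : G.Connected) (hbr : IsBridged G) (L : ℕ) :
    (∀ k, 2 * k < L → IntervalCondition G k) ∧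
      (∀ k, 2 * k + 1 < L → TriangleCondition G k) := by
  have tri : ∀ a b c : V, G.dist a c ≤ G.dist a b + G.dist b c :=
    fun a b c => hc.dist_triangle
  induction L with
  | zero => exact ⟨by omega, by omega⟩
  | succ L ih =>
    obtain ⟨hI, hT⟩ := ih
    refine ⟨fun k hk => ?_, fun k hk => ?_⟩
    · rcases Nat.lt_or_ge (2 * k) L with h | h
      · exact hI k h
      have hkL : L = 2 * k := by omega
      subst hkL
      intro p u a b hu ha hb ha' hb'
      rcases (by omega : k = 0 ∨ k = 1 ∨ 2 ≤ k) with rfl | rfl | hk2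
      · omega
      · left
        exact (hc.dist_eq_zero_iff.mp (by omega : G.dist p a = 0)).symm.trans
          (hc.dist_eq_zero_iff.mp (by omega : G.dist p b = 0))
      -- geodesics from `u` to `p` starting with `a` and with `b`
      obtain ⟨f, f0, fk, fd, fa⟩ := exists_geodesic_sequence hc p (k - 1) a (by omega)
      obtain ⟨g, g0, gk, gd, ga⟩ := exists_geodesic_sequence hc p (k - 1) b (by omega)
      have key : ∀ {f : ℕ → V} {a : V}, G.Adj u a → f 0 = p → f (k - 1) = a →
          (∀ i, i ≤ k - 1 → G.dist p (f i) = i) →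
          (∀ i, i < k - 1 → G.Adj (f i) (f (i + 1))) →
          ∃ f' : ℕ → V, f' 0 = u ∧ f' 1 = a ∧ f' k = p ∧
            (∀ i, i ≤ k → G.dist p (f' i) = k - i) ∧ (∀ i, i ≤ k → G.dist u (f' i) = i) ∧
            (∀ i, i < k → G.Adj (f' i) (f' (i + 1))) := by
        intro f a ha f0 fk fd fa
        have hadj : ∀ i, i < k → G.Adj ((fun i => if i = 0 then u else f (k - i)) i)
            ((fun i => if i = 0 then u else f (k - i)) (i + 1)) := by
          intro i hi
          by_cases h : i = 0
          · subst h
            simp only [if_true, Nat.zero_add, one_ne_zero, if_false, fk]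
            exact ha
          · simp only [h, if_false, Nat.succ_ne_zero]
            have := fa (k - (i + 1)) (by omega)
            rw [show k - (i + 1) + 1 = k - i by omega] at this
            exact this.symm
        have hpd : ∀ i, i ≤ k → G.dist p ((fun i => if i = 0 then u else f (k - i)) i) = k - i := by
          intro i hi
          by_cases h : i = 0
          · subst h; simpa using hu
          · simpa [h] using fd (k - i) (by omega)
        refine ⟨fun i => if i = 0 then u else f (k - i), by simp, by simpa using fk, ?_,
          hpd, ?_, hadj⟩
        · have : k ≠ 0 := by omega
          simp [this, f0]
        · intro i hi
          have h1 := dist_sequence_le hc hadj i 0 (by omega)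
          have h2 := tri p ((fun i => if i = 0 then u else f (k - i)) i) u
          rw [hpd i hi, hu, G.dist_comm (v := u)] at h2
          simp only [Nat.zero_add, if_true] at h1 h2 ⊢
          omega
      obtain ⟨f', f'0, f'1, f'k, f'p, f'd, f'a⟩ := key ha f0 fk fd fa
      obtain ⟨g', g'0, g'1, g'k, g'p, g'd, g'a⟩ := key hb g0 gk gd ga
      obtain ⟨i, j, hi, hj, hik, hjk, hij, h1, h2, h3⟩ := exists_shortcut_of_geodesics hc hbr
        (e := 0) (Or.inl ⟨rfl, f'k.trans g'k.symm⟩) (by omega) f'0 g'0 f'd g'd f'a g'a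
      obtain ⟨hik, hjk⟩ := h3 rfl
      have hif := f'd i hik.le
      have hjg := g'd j hjk.le
      have hpf := f'p i hik.le
      have hpg := g'p j hjk.le
      rw [G.dist_comm] at hif hjg
      obtain ⟨c, d, c1, d1, c2, d2, hcd⟩ := exists_adj_of_dist_lt_of_conditions hc hI hT (f' i)
        (g' j) j u hjg (by omega) hj (by omega) (by omega)
      have lower : ∀ {x c : V} {i : ℕ}, G.Adj u c → G.dist p x = k - i → G.dist x u = i → i < k →
          G.dist x c + 1 = i → G.dist p c + 1 = k := by
        intro x c i huc hx hxu hi hxc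
        have h1 := tri p x c
        have h2 := dist_le_add_one_of_adj hc p huc.symm
        omega
      have hc2 := lower c1 hpf hif hik (by omega)
      have hd2 := lower d1 hpg hjg hjk (by omega)
      have hac := hI i (by omega) (f' i) u a c hif ha c1 (by
        have h := dist_sequence_le hc f'a (i - 1) 1 (by omega)
        rw [show 1 + (i - 1) = i by omega, f'1, G.dist_comm] at h
        have := dist_le_add_one_of_adj hc (f' i) ha.symm
        omega) c2
      have hdb := hI j (by omega) (g' j) u d b hjg d1 hb d2 (by
        have h := dist_sequence_le hc g'a (j - 1) 1 (by omega)
        rw [show 1 + (j - 1) = j by omega, g'1, G.dist_comm] at h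
        have := dist_le_add_one_of_adj hc (g' j) hb.symm
        omega)
      -- `a`, `c`, `d`, `b` is a path among the neighbors of `u` in `I(p,u)`
      have trans := fun {a b c} => adj_trans_of_conditions hc hbr (p := p) (a := a) (b := b)
        (c := c) (hI (k - 1) (by omega)) (hT (k - 1) (by omega)) hu
      exact trans ha c1 hb (by omega) hc2 (by omega) hac
        (trans c1 d1 hb hc2 hd2 (by omega) hcd hdb)
    · rcases Nat.lt_or_ge (2 * k + 1) L with h | h
      · exact hT k h
      have hkL : L = 2 * k + 1 := by omega
      subst hkL
      intro p a b ha hb hk0 hab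
      rcases (by omega : k = 1 ∨ 2 ≤ k) with rfl | hk2
      · refine ⟨p, ?_, ?_, by simp⟩
        · rw [← SimpleGraph.dist_eq_one_iff_adj, G.dist_comm, ha]
        · rw [← SimpleGraph.dist_eq_one_iff_adj, G.dist_comm, hb]
      obtain ⟨f, f0, fk, fd, fa⟩ := exists_geodesic_sequence hc p k a ha
      obtain ⟨g, g0, gk, gd, ga⟩ := exists_geodesic_sequence hc p k b hb
      obtain ⟨i, j, hi, hj, hik, hjk, hij, h1, h2, -⟩ := exists_shortcut_of_geodesics hc hbr
        (e := 1) (Or.inr ⟨rfl, by rwa [fk, gk]⟩) (by omega) f0 g0 fd gd fa ga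
      have hif := fd i hik
      have hjg := gd j hjk
      rw [G.dist_comm] at hif hjg
      obtain ⟨c, d, c1, d1, c2, d2, hcd⟩ := exists_adj_of_dist_lt_of_conditions hc hI hT (f i)
        (g j) j p hjg (by omega) hj (by omega) (by omega)
      have lower : ∀ {x c y : V} {i : ℕ}, G.Adj p c → G.dist x p = i → G.dist x c + 1 = i →
          G.dist x y ≤ k - i → G.dist p y = k → i ≤ k → G.dist c y + 1 = k := by
        intro x c y i hpc hx hxc hxy hy hi
        have h1 := tri c x y
        have h2 := dist_le_add_one_of_adj hc y hpc.symm
        rw [G.dist_comm (u := c) (v := x)] at h1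
        rw [G.dist_comm (u := y), G.dist_comm (u := y)] at h2
        omega
      have hca := lower c1 hif (by omega) (by
        have := dist_sequence_le hc fa (k - i) i (by omega)
        rwa [show i + (k - i) = k by omega, fk] at this) ha hik
      have hdb := lower d1 hjg (by omega) (by
        have := dist_sequence_le hc ga (k - j) j (by omega)
        rwa [show j + (k - j) = k by omega, gk] at this) hb hjk
      have same : G.dist c b + 1 = k → ∃ c, G.Adj a c ∧ G.Adj b c ∧ G.dist p c + 1 = k := by
        intro hcb
        obtain ⟨e, e1, e2, e3⟩ := hT (k - 1) (by omega) c a b (by omega) (by omega) (by omega) hab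
        refine ⟨e, e1, e2, ?_⟩
        have h1 := tri p c e
        rw [SimpleGraph.dist_eq_one_iff_adj.mpr c1] at h1
        have h2 := dist_le_add_one_of_adj hc p e1.symm
        omega
      rcases hcd with rfl | hcd
      · exact same hdb
      by_cases hcb : G.dist c b + 1 = k
      · exact same hcb
      have t1 := tri c d b
      have t2 := tri p c b
      rw [SimpleGraph.dist_eq_one_iff_adj.mpr hcd] at t1
      rw [SimpleGraph.dist_eq_one_iff_adj.mpr c1] at t2
      -- now `d(c,b) = k`; the predecessor `e` of `b` on a geodesic from `d`, like `a`, is in `I(c,b)`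
      obtain ⟨e, e1, e2⟩ := exists_adj_dist_add_one hc d (u := b) (by omega)
      have t3 := tri c d e
      rw [SimpleGraph.dist_eq_one_iff_adj.mpr hcd] at t3
      have t4 := dist_le_add_one_of_adj hc c e1.symm
      have t5 := tri p d e
      rw [SimpleGraph.dist_eq_one_iff_adj.mpr d1] at t5
      have t6 := dist_le_add_one_of_adj hc p e1.symm
      rcases hI k (by omega) c b a e (by omega) hab.symm e1 (by omega) (by omega) with rfl | hae
      · omega
      · exact ⟨e, hae, e1, by omega⟩

theorem adj_of_mem_interval (hc : G.Connected) (hbr : IsBridged G) {p u a b : V} (ha : G.Adj u a)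
    (hb : G.Adj u b) (ha' : G.dist p a + 1 = G.dist p u) (hb' : G.dist p b + 1 = G.dist p u) :
    a = b ∨ G.Adj a b :=
  (conditions_below hc hbr (2 * G.dist p u + 1)).1 _ (by omega) p u a b rfl ha hb ha' hb'

theorem triangle_condition (hc : G.Connected) (hbr : IsBridged G) {p a b : V} (hab : G.Adj a b)
    (h : G.dist p a = G.dist p b) (h0 : 0 < G.dist p a) :
    ∃ c, G.Adj a c ∧ G.Adj b c ∧ G.dist p c + 1 = G.dist p a :=
  (conditions_below hc hbr (2 * G.dist p a + 2)).2 _ (by omega) p a b rfl h.symm h0 hab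

/-- If `u` is not between `p` and `q`, then geodesics from `u` to `p` and to `q` can be chosen to start
with equal or adjacent vertices. -/
theorem exists_adj_of_dist_lt (hc : G.Connected) (hbr : IsBridged G) {p q u : V}
    (hp : 0 < G.dist p u) (hq : 0 < G.dist q u) (h : G.dist p q < G.dist p u + G.dist q u) :
    ∃ a b, G.Adj u a ∧ G.Adj u b ∧ G.dist p a + 1 = G.dist p u ∧ G.dist q b + 1 = G.dist q u ∧
      (a = b ∨ G.Adj a b) :=
  have hL := conditions_below hc hbr (G.dist p u + G.dist q u + G.dist p q + 1)
  exists_adj_of_dist_lt_of_conditions hc hL.1 hL.2 p q _ u rfl hp hq h (by omega)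

/-! ### Convexity properties -/

/-- A form of the convexity of balls: once the distance to `p` has increased from `a` to `t` along a
geodesic from `a` through `t` to `c`, it does not drop below `d(p,t)` at `c`. -/
theorem dist_le_of_increase (hc : G.Connected) (hbr : IsBridged G) (p c : V) :
    ∀ (m : ℕ) (t a : V), G.dist c t = m → G.Adj t a → G.dist p t = G.dist p a + 1 →
      G.dist c a = m + 1 → G.dist p t ≤ G.dist p c := by
  intro m
  induction m with
  | zero =>
    intro t a ht _ _ _
    rw [hc.dist_eq_zero_iff.mp ht]
  | succ m ih =>
    intro t a ht hta hpt hca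
    by_contra hlt
    obtain ⟨b, e, hb, he, hb', he', hbe⟩ :=
      exists_adj_of_dist_lt hc hbr (p := p) (q := c) (u := t) (by omega) (by omega) (by omega)
    have far : ¬ (a = e ∨ G.Adj a e) := by
      rintro (rfl | h)
      · omega
      · have := dist_le_add_one_of_adj hc c h.symm
        omega
    rcases adj_of_mem_interval hc hbr hta hb hpt.symm hb' with rfl | hab
    · exact far hbe
    rcases hbe with rfl | hbe
    · exact far (Or.inr hab)
    have h1 := dist_le_add_one_of_adj hc p hbe
    have h2 := dist_le_add_one_of_adj hc p he.symm
    have h3 := dist_le_add_one_of_adj hc c hbe.symm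
    have h4 := dist_le_add_one_of_adj hc c hab.symm
    by_cases h : G.dist p e + 1 = G.dist p t
    · exact far (adj_of_mem_interval hc hbr hta he hpt.symm h)
    · have := ih e b (by omega) hbe.symm (by omega) (by omega)
      omega

/-- If the intervals `I(w,p)` and `I(w,q)` share no neighbor of `w`, then `p` is at least as far
from `q` as from `w`. -/
theorem dist_le_of_no_common_neighbor (hc : G.Connected) (hbr : IsBridged G) {w p q : V}
    (h : ∀ t, G.Adj w t → G.dist p t + 1 = G.dist p w → G.dist q t + 1 = G.dist q w → False) :
    G.dist p w ≤ G.dist p q := by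
  by_contra hlt
  have hq : 0 < G.dist q w := by
    rcases Nat.eq_zero_or_pos (G.dist q w) with h0 | h0
    · rw [hc.dist_eq_zero_iff.mp h0] at hlt
      omega
    · exact h0
  obtain ⟨a, b, ha, hb, ha', hb', hab⟩ :=
    exists_adj_of_dist_lt hc hbr (p := p) (q := q) (u := w) (by omega) hq (by omega)
  rcases hab with rfl | hab
  · exact h a ha ha' hb'
  have h1 := fun h' => h a ha ha' h'
  have h2 := fun h' => h b hb h' hb'
  have h3 := dist_le_add_one_of_adj hc q hab.symm
  have h4 := dist_le_add_one_of_adj hc q ha.symm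
  have h5 := dist_le_add_one_of_adj hc p hab
  have h6 := dist_le_add_one_of_adj hc p hb.symm
  have h7 : G.dist q a + 1 ≠ G.dist q w := h1
  have h8 : G.dist p b + 1 ≠ G.dist p w := h2
  have := dist_le_of_increase hc hbr p q (G.dist q b) b a rfl hab.symm (by omega) (by omega)
  omega

/-- A local form of the convexity of balls around an edge `uv`: two nonadjacent neighbors `b`, `c`
of `z` cannot lie in the ball of radius `k - 1` around `{u, v}`, one on each side, if `z` has
distance `k` to `u` and `v`. The triangle condition yields the same configuration at distance
`k - 1`, the new nonadjacent pair being provided by the absence of induced 5-cycles. -/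
theorem edge_ball_convex (hc : G.Connected) (hbr : IsBridged G) {u v : V} (huv : G.Adj u v) :
    ∀ (k : ℕ) (z b c : V), G.Adj z b → G.Adj z c → ¬ G.Adj b c → G.dist u z = k → G.dist v z = k →
      G.dist u b + 1 = k → G.dist v c + 1 = k → G.dist v b = k → G.dist u c = k → False := by
  have tri : ∀ a b c : V, G.dist a c ≤ G.dist a b + G.dist b c := fun a b c => hc.dist_triangle
  intro k
  induction k with
  | zero => intros; omega
  | succ k ih =>
    intro z b c hzb hzc hbc huz hvz hub hvc hvb huc
    rcases Nat.eq_zero_or_pos k with rfl | hk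
    · have h1 : u = b := hc.dist_eq_zero_iff.mp (by omega)
      have h2 : v = c := hc.dist_eq_zero_iff.mp (by omega)
      exact hbc (h1 ▸ h2 ▸ huv)
    obtain ⟨p, hup, hvp, hzp⟩ := triangle_condition hc hbr (p := z) huv
      (by rw [G.dist_comm, huz, G.dist_comm, hvz]) (by rw [G.dist_comm, huz]; omega)
    rw [G.dist_comm (u := z), G.dist_comm (u := z), huz] at hzp
    obtain ⟨a, hza, hpa⟩ := exists_adj_dist_add_one hc p (u := z) (by omega)
    have near : ∀ {x : V}, G.Adj x p → G.dist x z = k + 1 → G.dist x a = k := by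
      intro x hx hxz
      have h1 := tri x p a
      rw [SimpleGraph.dist_eq_one_iff_adj.mpr hx] at h1
      have h2 := dist_le_add_one_of_adj hc x hza.symm
      omega
    have hua := near hup huz
    have hva := near hvp hvz
    have hab : G.Adj a b := by
      rcases adj_of_mem_interval hc hbr hza hzb (p := u) (by omega) (by omega) with rfl | h
      · omega
      · exact h
    have hac : G.Adj a c := by
      rcases adj_of_mem_interval hc hbr hza hzc (p := v) (by omega) (by omega) with rfl | h
      · omega
      · exact h
    obtain ⟨x, hax, hbx, hux⟩ := triangle_condition hc hbr (p := u) hab (by omega) (by omega)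
    obtain ⟨y, hay, hcy, hvy⟩ := triangle_condition hc hbr (p := v) hac (by omega) (by omega)
    have hvx1 := dist_le_add_one_of_adj hc v hbx.symm
    have hvx2 := tri v u x
    have huy1 := dist_le_add_one_of_adj hc u hcy.symm
    have huy2 := tri u v y
    rw [SimpleGraph.dist_eq_one_iff_adj.mpr huv] at huy2
    rw [SimpleGraph.dist_eq_one_iff_adj.mpr huv.symm] at hvx2
    refine ih a x y hax hay ?_ hua hva (by omega) (by omega) (by omega) (by omega)
    intro hxy
    have far : ∀ {o s t : V}, G.dist o s + 2 ≤ G.dist o t → ¬ G.Adj s t := by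
      intro o s t h h'
      have := dist_le_add_one_of_adj hc o h'
      omega
    exact not_induced_pentagon hc hbr hzb hbx hxy hcy.symm hzc.symm
      (fun h => far (o := u) (by omega) h.symm)
      (fun h => far (o := v) (by omega) h.symm)
      (far (o := u) (by omega)) (far (o := v) (by omega)) (fun h => hbc h.symm)

/-! ### Gates -/

theorem not_k4 (hK : G.CliqueFree 4) {a b c d : V} (hab : G.Adj a b) (hac : G.Adj a c)
    (had : G.Adj a d) (hbc : G.Adj b c) (hbd : G.Adj b d) (hcd : G.Adj c d) : False := by
  classical
  refine hK _ ((SimpleGraph.is3Clique_triple_iff.mpr ⟨hbc, hbd, hcd⟩).insert (a := a) ?_)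
  intro x hx
  simp only [Finset.mem_insert, Finset.mem_singleton] at hx
  rcases hx with rfl | rfl | rfl <;> assumption

/-- The vertex `e` is a gate of `u` (with respect to `z`) if it is a neighbor of `z` in `I(z,u)`.
For `u ≠ z` the gates of `u` form its metric projection on `N[z]`. -/
def IsGate (G : SimpleGraph V) (z u e : V) : Prop :=
  G.Adj z e ∧ G.dist e u + 1 = G.dist z u

theorem exists_isGate (hc : G.Connected) {z u : V} (h : u ≠ z) : ∃ e, IsGate G z u e := by
  obtain ⟨e, he, he'⟩ := exists_adj_dist_add_one hc u (u := z) (hc.pos_dist_of_ne h)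
  exact ⟨e, he, by rw [G.dist_comm, he', G.dist_comm]⟩

theorem IsGate.pos {z u e : V} (h : IsGate G z u e) : 0 < G.dist z u := by
  have := h.2
  omega

theorem IsGate.eq_or_adj (hc : G.Connected) (hbr : IsBridged G) {z u a b : V}
    (ha : IsGate G z u a) (hb : IsGate G z u b) : a = b ∨ G.Adj a b := by
  have h1 := ha.2
  have h2 := hb.2
  rw [G.dist_comm, G.dist_comm (u := z)] at h1 h2
  exact adj_of_mem_interval hc hbr ha.1 hb.1 h1 h2

/-- A vertex has at most two gates in a `K₄`-free bridged graph. -/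
theorem IsGate.eq_or_eq (hc : G.Connected) (hbr : IsBridged G) (hK : G.CliqueFree 4)
    {z u a b e : V} (ha : IsGate G z u a) (hb : IsGate G z u b) (hab : a ≠ b)
    (he : IsGate G z u e) : e = a ∨ e = b := by
  by_contra hno
  push Not at hno
  exact not_k4 hK ha.1 hb.1 he.1 ((ha.eq_or_adj hc hbr hb).resolve_left hab)
    ((ha.eq_or_adj hc hbr he).resolve_left hno.1.symm)
    ((hb.eq_or_adj hc hbr he).resolve_left hno.2.symm)

theorem IsGate.mono (hc : G.Connected) {z u t e : V} (h : IsGate G z t e)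
    (ht : G.dist z t + G.dist t u = G.dist z u) : IsGate G z u e := by
  refine ⟨h.1, ?_⟩
  have h1 := hc.dist_triangle (u := e) (v := t) (w := u)
  have h2 := dist_le_add_one_of_adj hc u h.1.symm
  rw [G.dist_comm (u := u), G.dist_comm (u := u)] at h2
  have := h.2
  omega

theorem IsGate.of_adj (hc : G.Connected) {z u t e : V} (h : IsGate G z t e) (htu : G.Adj t u)
    (ht : G.dist z t + 1 = G.dist z u) : IsGate G z u e :=
  h.mono hc (by rw [SimpleGraph.dist_eq_one_iff_adj.mpr htu, ht])

/-- The gate sets of two adjacent vertices, not both neighbors of `z`, are nested. In particular, no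
edge joins two distinct cones. -/
theorem isGate_nested (hc : G.Connected) (hbr : IsBridged G) (hK : G.CliqueFree 4) {z u v : V}
    (huv : G.Adj u v) (h : ¬ (G.dist z u = 1 ∧ G.dist z v = 1)) :
    (∀ e, IsGate G z u e → IsGate G z v e) ∨ (∀ e, IsGate G z v e → IsGate G z u e) := by
  have h1 := dist_le_add_one_of_adj hc z huv
  have h2 := dist_le_add_one_of_adj hc z huv.symm
  rcases (by omega : G.dist z u + 1 = G.dist z v ∨ G.dist z v + 1 = G.dist z u ∨
    G.dist z u = G.dist z v) with h | h | heq
  · exact Or.inl fun e he => he.of_adj hc huv h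
  · exact Or.inr fun e he => he.of_adj hc huv.symm h
  by_contra hno
  push Not at hno
  obtain ⟨⟨b, hub, hvb⟩, c, hvc, huc⟩ := hno
  have h0 := hub.pos
  obtain ⟨p, hup, hvp, hzp⟩ := triangle_condition hc hbr huv heq h0
  have hpz : p ≠ z := by
    rintro rfl
    rw [SimpleGraph.dist_self] at hzp
    omega
  obtain ⟨a, ha⟩ := exists_isGate hc hpz
  have hua := ha.of_adj hc hup.symm hzp
  have hva := ha.of_adj hc hvp.symm (by omega)
  have hab : G.Adj a b := (hua.eq_or_adj hc hbr hub).resolve_left (by rintro rfl; exact hvb hva)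
  have hac : G.Adj a c := (hva.eq_or_adj hc hbr hvc).resolve_left (by rintro rfl; exact huc hua)
  have far : ∀ {x y : V}, G.Adj z x → G.dist z u = G.dist z y → ¬ IsGate G z y x →
      G.dist y a + 1 = G.dist y z → G.Adj a x → G.dist y x = G.dist z u := by
    intro x y hzx hy hx hya hax
    have e1 := dist_le_add_one_of_adj hc y hzx.symm
    have e2 := dist_le_add_one_of_adj hc y hax
    have e3 : G.dist x y + 1 ≠ G.dist z y := fun h => hx ⟨hzx, h⟩
    rw [G.dist_comm (u := x)] at e3
    rw [G.dist_comm (v := z)] at e1 hya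
    omega
  have hub2 := hub.2
  have hvc2 := hvc.2
  have hua2 := hua.2
  have hva2 := hva.2
  rw [G.dist_comm, G.dist_comm (u := z)] at hua2 hva2
  refine edge_ball_convex hc hbr huv (G.dist z u) z b c hub.1 hvc.1 ?_ G.dist_comm
    (by rw [heq, G.dist_comm]) ?_ ?_ (far hub.1 heq hvb hva2 hab) (far hvc.1 rfl huc hua2 hac)
  · intro hbc
    exact not_k4 hK ha.1 hub.1 hvc.1 hab hac hbc
  · rw [G.dist_comm]; exact hub2
  · rw [G.dist_comm, heq]; exact hvc2

/-- Two gates `a ≠ b` of `t` have a common neighbor one step closer to `t`. -/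
theorem exists_apex (hc : G.Connected) (hbr : IsBridged G) {z t a b : V} (ha : IsGate G z t a)
    (hb : IsGate G z t b) (hab : a ≠ b) :
    ∃ x, G.Adj x a ∧ G.Adj x b ∧ G.dist x t + 1 = G.dist a t := by
  have h1 := ha.2
  have h2 := hb.2
  have h3 : 0 < G.dist t a := by
    rcases Nat.eq_zero_or_pos (G.dist t a) with h | h
    · have := hc.dist_eq_zero_iff.mp h
      subst this
      rw [SimpleGraph.dist_self] at h1
      exact absurd (hc.dist_eq_zero_iff.mp (by omega : G.dist b t = 0)).symm hab
    · exact h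
  obtain ⟨x, hx1, hx2, hx3⟩ := triangle_condition hc hbr (p := t)
    ((ha.eq_or_adj hc hbr hb).resolve_left hab)
    (by rw [G.dist_comm, G.dist_comm (v := b)]; omega) h3
  exact ⟨x, hx1.symm, hx2.symm, by rw [G.dist_comm, hx3, G.dist_comm]⟩

/-- The apex of a cone is unique. -/
theorem apex_unique (hc : G.Connected) (hbr : IsBridged G) (hK : G.CliqueFree 4) {t a b x y : V}
    (hab : G.Adj a b) (hxa : G.Adj x a) (hxb : G.Adj x b) (hx : G.dist x t + 1 = G.dist a t)
    (hya : G.Adj y a) (hyb : G.Adj y b) (hy : G.dist y t + 1 = G.dist a t) : x = y := by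
  rw [G.dist_comm, G.dist_comm (u := a)] at hx hy
  rcases adj_of_mem_interval hc hbr hxa.symm hya.symm hx hy with h | h
  · exact h
  · exact (not_k4 hK hab hxa.symm hya.symm hxb.symm hyb.symm h).elim

/-! ### Panels, cones and boundaries -/

/-- Membership in the panel `F(w)`, for `w` adjacent to `z`: `w` is the only gate. -/
def InPanel (G : SimpleGraph V) (z w p : V) : Prop :=
  IsGate G z p w ∧ ∀ e, IsGate G z p e → e = w

/-- Membership in the total boundary of the panel `F(w)`: `p` is `w` itself or has a neighbor in a
cone that has `w` as a gate. -/
def OnBoundary (G : SimpleGraph V) (z w p : V) : Prop :=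
  InPanel G z w p ∧ (p = w ∨ ∃ t e, G.Adj p t ∧ IsGate G z t w ∧ IsGate G z t e ∧ e ≠ w)

/-- Membership in the cone `F(x)` with gates `w` and `b`. -/
structure InCone (G : SimpleGraph V) (z w b x u : V) : Prop where
  gate_left : IsGate G z u w
  gate_right : IsGate G z u b
  ne : b ≠ w
  adj_left : G.Adj x w
  adj_right : G.Adj x b
  dist_add_one : G.dist x u + 1 = G.dist w u

theorem IsGate.dist_interval (hc : G.Connected) {z w r t : V} (h : IsGate G z t w)
    (hz : G.Adj z w) (hr : G.dist w r + G.dist r t = G.dist w t) : IsGate G z r w := by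
  refine ⟨hz, ?_⟩
  have h1 := hc.dist_triangle (u := z) (v := r) (w := t)
  have h2 := dist_le_add_one_of_adj hc r hz.symm
  rw [G.dist_comm (u := r), G.dist_comm (u := r)] at h2
  have := h.2
  omega

theorem InPanel.of_interval (hc : G.Connected) {z w r p : V} (h : InPanel G z w p)
    (hr : G.dist w r + G.dist r p = G.dist w p) : InPanel G z w r := by
  have hg := h.1.dist_interval hc h.1.1 hr
  refine ⟨hg, fun e he => h.2 e (he.mono hc ?_)⟩
  have h1 := hg.2
  have h2 := h.1.2
  omega

theorem InPanel.dist_le (hc : G.Connected) {z w q e x : V} (h : InPanel G z w q)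
    (he : G.Adj z e) (hew : e ≠ w) (hx : G.Adj x e) : G.dist w q ≤ G.dist x q := by
  have h1 : G.dist e q + 1 ≠ G.dist z q := fun h' => hew (h.2 e ⟨he, h'⟩)
  have h2 := h.1.2
  have h3 := dist_le_add_one_of_adj hc q he.symm
  have h4 := dist_le_add_one_of_adj hc q hx
  rw [G.dist_comm (u := q), G.dist_comm (u := q)] at h3 h4
  omega

/-- A boundary vertex `p ≠ w` of the panel `F(w)` has a neighbor on its own level in a cone; the
distances of `p` to the apex of this cone and to `w` are equal. -/
theorem OnBoundary.exists_level_neighbor (hc : G.Connected) (hbr : IsBridged G) {z w p : V}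
    (hp : OnBoundary G z w p) (hpw : p ≠ w) :
    ∃ t e x, G.Adj p t ∧ IsGate G z t w ∧ IsGate G z t e ∧ e ≠ w ∧ G.dist w t = G.dist w p ∧
      G.Adj x w ∧ G.Adj x e ∧ G.dist x t + 1 = G.dist w t ∧ G.dist x p = G.dist w p := by
  obtain ⟨hpan, h | ⟨t, e, hpt, htw, hte, hew⟩⟩ := hp
  · exact absurd h hpw
  obtain ⟨x, hxw, hxe, hx⟩ := exists_apex hc hbr htw hte hew.symm
  have hlow := hpan.dist_le hc hte.1 hew hxe
  have hpg := hpan.1.2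
  have htg := htw.2
  have htge := hte.2
  have hz1 := dist_le_add_one_of_adj hc z hpt
  have hz2 := dist_le_add_one_of_adj hc z hpt.symm
  have hne : G.dist z t + 1 ≠ G.dist z p := fun h =>
    hew (hpan.2 e (hte.of_adj hc hpt.symm h))
  by_cases hlev : G.dist z t = G.dist z p
  · have := dist_le_add_one_of_adj hc x hpt.symm
    exact ⟨t, e, x, hpt, htw, hte, hew, by omega, hxw, hxe, hx, by omega⟩
  have hp0 : 0 < G.dist w p := hc.pos_dist_of_ne hpw.symm
  -- `t` lies one level above `p`; its neighbor `h` towards the apex lies on the level of `p`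
  obtain ⟨h, hth, hxh⟩ := exists_adj_dist_add_one hc x (u := t) (by omega)
  have hwh1 := dist_le_add_one_of_adj hc w hth.symm
  have hwh2 := dist_le_add_one_of_adj hc h hxw
  rw [G.dist_comm, G.dist_comm (u := h)] at hwh2
  have heh := dist_le_add_one_of_adj hc h hxe
  rw [G.dist_comm, G.dist_comm (u := h)] at heh
  have hzh1 := dist_le_add_one_of_adj hc z hth.symm
  have hzh2 := dist_le_add_one_of_adj hc h htw.1.symm
  rw [G.dist_comm, G.dist_comm (u := h)] at hzh2
  have hzh3 := dist_le_add_one_of_adj hc h hte.1.symm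
  rw [G.dist_comm, G.dist_comm (u := h)] at hzh3
  have hhe : IsGate G z h e := ⟨hte.1, by omega⟩
  have hph : G.Adj p h := by
    refine (adj_of_mem_interval hc hbr (p := w) hpt.symm hth (by omega)
      (by omega)).resolve_left ?_
    rintro rfl
    exact hew (hpan.2 e hhe)
  have := dist_le_add_one_of_adj hc x hph.symm
  exact ⟨h, e, x, hph, ⟨htw.1, by omega⟩, hhe, hew, by omega, hxw, hxe, by omega, by omega⟩

/-- A boundary vertex `p ≠ w` of the panel `F(w)` has exactly one neighbor closer to `w`, and this
neighbor is on the boundary as well. A second one would, together with a neighbor of `p` in a cone,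
contradict the convexity of balls around the edge joining `w` to the apex of that cone. -/
theorem OnBoundary.exists_unique_lower (hc : G.Connected) (hbr : IsBridged G)
    (hK : G.CliqueFree 4) {z w p : V} (hp : OnBoundary G z w p) (hpw : p ≠ w) :
    ∃ r, G.Adj p r ∧ G.dist w r + 1 = G.dist w p ∧ OnBoundary G z w r ∧
      ∀ r', G.Adj p r' → G.dist w r' + 1 = G.dist w p → r' = r := by
  obtain ⟨t, e, x, hpt, htw, hte, hew, hlev, hxw, hxe, hxt, hxp⟩ :=
    hp.exists_level_neighbor hc hbr hpw
  have hp0 : 0 < G.dist w p := hc.pos_dist_of_ne hpw.symm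
  obtain ⟨r, hpr, htr, hr⟩ := triangle_condition hc hbr (p := w) hpt hlev.symm hp0
  have below : ∀ {r : V}, G.Adj p r → G.dist w r + 1 = G.dist w p → InPanel G z w r := by
    intro r hpr hr
    refine hp.1.of_interval hc ?_
    rw [SimpleGraph.dist_eq_one_iff_adj.mpr hpr.symm, hr]
  refine ⟨r, hpr, hr, ⟨below hpr hr, Or.inr ⟨t, e, htr.symm, htw, hte, hew⟩⟩, ?_⟩
  intro r' hpr' hr'
  by_contra hne
  have hrr := (adj_of_mem_interval hc hbr hpr hpr' hr hr').resolve_left (Ne.symm hne)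
  have htr' : ¬ G.Adj t r' := fun h => not_k4 hK hpt hpr hpr' htr h hrr
  have h1 := (below hpr' hr').dist_le hc hte.1 hew hxe
  have h2 := dist_le_add_one_of_adj hc r' hxw.symm
  rw [G.dist_comm, G.dist_comm (u := r')] at h2
  have h3 : G.dist x r' + 1 ≠ G.dist x p := by
    intro h
    rcases adj_of_mem_interval hc hbr hpt hpr' (by omega) h with rfl | h
    · omega
    · exact htr' h
  exact edge_ball_convex hc hbr hxw (G.dist w p) p t r' hpt hpr' htr' hxp rfl (by omega) hr' hlev
    (by omega)

/-- The total boundary of a panel is starshaped. -/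
theorem OnBoundary.of_interval (hc : G.Connected) (hbr : IsBridged G) (hK : G.CliqueFree 4)
    {z w r : V} : ∀ (n : ℕ) (p : V), G.dist w p = n → OnBoundary G z w p →
      G.dist w r + G.dist r p = G.dist w p → OnBoundary G z w r := by
  intro n
  induction n with
  | zero =>
    intro p hn hp hr
    rwa [hc.dist_eq_zero_iff.mp (by omega : G.dist r p = 0)]
  | succ n ih =>
    intro p hn hp hr
    rcases Nat.eq_zero_or_pos (G.dist r p) with h0 | h0
    · rwa [hc.dist_eq_zero_iff.mp h0]
    have hpw : p ≠ w := by
      rintro rfl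
      rw [SimpleGraph.dist_self] at hn
      omega
    obtain ⟨q, hpq, hq, hqb, huniq⟩ := hp.exists_unique_lower hc hbr hK hpw
    obtain ⟨s, hps, hs⟩ := exists_adj_dist_add_one hc r h0
    have h1 := hc.dist_triangle (u := w) (v := r) (w := s)
    have h2 := dist_le_add_one_of_adj hc w hps.symm
    obtain rfl := huniq s hps (by omega)
    exact ih s (by omega) hqb (by omega)

namespace InCone

variable {z w b x u : V}

theorem adj_gates (hc : G.Connected) (hbr : IsBridged G) (hu : InCone G z w b x u) : G.Adj w b :=
  (hu.gate_left.eq_or_adj hc hbr hu.gate_right).resolve_left hu.ne.symm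

theorem not_inPanel (hu : InCone G z w b x u) : ¬ InPanel G z w u :=
  fun h => hu.ne (h.2 b hu.gate_right)

theorem eq_or_eq (hc : G.Connected) (hbr : IsBridged G) (hK : G.CliqueFree 4)
    (hu : InCone G z w b x u) {e : V} (he : IsGate G z u e) : e = w ∨ e = b :=
  IsGate.eq_or_eq hc hbr hK hu.gate_left hu.gate_right hu.ne.symm he

/-- A vertex `r` of the panel `F(w)` on a geodesic from `w` to a vertex `u` of a neighboring cone
has a neighbor outside the panel that is one step closer to `u`. -/
theorem exists_exit (hc : G.Connected) (hbr : IsBridged G) (hu : InCone G z w b x u) {r : V}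
    (hr : InPanel G z w r) (hru : G.dist w r + G.dist r u = G.dist w u) :
    ∃ s, G.Adj r s ∧ G.dist u s + 1 = G.dist u r ∧ ¬ InPanel G z w s := by
  have h0 := hu.dist_add_one
  have hxg := hu.gate_right.1
  by_cases hrw : r = w
  · subst hrw
    refine ⟨x, hu.adj_left.symm, by rw [G.dist_comm, h0, G.dist_comm], fun h => ?_⟩
    have h1 := h.dist_le hc hxg hu.ne hu.adj_right
    rw [SimpleGraph.dist_self, SimpleGraph.dist_eq_one_iff_adj.mpr hu.adj_left.symm] at h1
    omega
  have hw0 : 0 < G.dist w r := hc.pos_dist_of_ne (Ne.symm hrw)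
  have hlow := hr.dist_le hc hxg hu.ne hu.adj_right
  -- the first vertex of a geodesic from `w` to `r` is adjacent to the apex `x`
  have hup : G.dist x r ≤ G.dist w r := by
    obtain ⟨q, hwq, hq⟩ := exists_adj_dist_add_one hc r (u := w) (by rwa [G.dist_comm])
    rw [G.dist_comm, G.dist_comm (u := r)] at hq
    have h1 := hc.dist_triangle (u := q) (v := r) (w := u)
    have h2 := dist_le_add_one_of_adj hc u hwq.symm
    rw [G.dist_comm (u := u), G.dist_comm (u := u)] at h2
    rcases adj_of_mem_interval hc hbr (p := u) hu.adj_left.symm hwq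
      (by rw [G.dist_comm, h0, G.dist_comm])
      (by rw [G.dist_comm, G.dist_comm (u := u)]; omega) with rfl | h
    · omega
    · have h3 := dist_le_add_one_of_adj hc r h.symm
      rw [G.dist_comm, G.dist_comm (u := r)] at h3
      omega
  have hru0 : 0 < G.dist r u := by
    refine hc.pos_dist_of_ne ?_
    rintro rfl
    exact hu.not_inPanel hr
  obtain ⟨a, s, hra, hrs, ha, hs, has⟩ := exists_adj_of_dist_lt hc hbr (p := x) (q := u) (u := r)
    (by omega) (by rwa [G.dist_comm]) (by rw [G.dist_comm (u := u)]; omega)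
  refine ⟨s, hrs, hs, fun hsp => ?_⟩
  have h1 := hsp.dist_le hc hxg hu.ne hu.adj_right
  have h2 := hc.dist_triangle (u := w) (v := s) (w := u)
  rw [G.dist_comm (u := s)] at h2
  rw [G.dist_comm (u := r)] at hru
  rcases has with rfl | has
  · omega
  · have := dist_le_add_one_of_adj hc x has
    omega

theorem onBoundary (hc : G.Connected) (hbr : IsBridged G) (hu : InCone G z w b x u)
    {r : V} (hr : InPanel G z w r) (hru : G.dist w r + G.dist r u = G.dist w u) :
    OnBoundary G z w r := by
  obtain ⟨s, hrs, hs, hsp⟩ := hu.exists_exit hc hbr hr hru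
  refine ⟨hr, Or.inr ?_⟩
  have hsw : IsGate G z s w := by
    refine hu.gate_left.dist_interval hc hr.1.1 ?_
    have h1 := dist_le_add_one_of_adj hc w hrs
    have h2 := hc.dist_triangle (u := w) (v := s) (w := u)
    rw [G.dist_comm, G.dist_comm (u := u)] at hs
    omega
  by_contra hno
  push Not at hno
  exact hsp ⟨hsw, fun e he => hno s e hrs hsw he⟩

/-- The vertices of the panel `F(w)` in `I(w,u)` do not branch: a third vertex, outside the panel,
would complete two successors of `r` and `r` itself to a `K₄`. -/
theorem succ_unique (hc : G.Connected) (hbr : IsBridged G) (hK : G.CliqueFree 4)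
    (hu : InCone G z w b x u) {r p q : V} (hr : InPanel G z w r)
    (hru : G.dist w r + G.dist r u = G.dist w u) (hrp : G.Adj r p) (hrq : G.Adj r q)
    (hp : G.dist u p + 1 = G.dist u r) (hq : G.dist u q + 1 = G.dist u r)
    (hpp : InPanel G z w p) (hqp : InPanel G z w q) : p = q := by
  by_contra hne
  obtain ⟨s, hrs, hs, hsp⟩ := hu.exists_exit hc hbr hr hru
  refine not_k4 hK hrs hrp hrq ?_ ?_
    ((adj_of_mem_interval hc hbr hrp hrq hp hq).resolve_left hne)
  · exact (adj_of_mem_interval hc hbr hrs hrp hs hp).resolve_left (by rintro rfl; exact hsp hpp)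
  · exact (adj_of_mem_interval hc hbr hrs hrq hs hq).resolve_left (by rintro rfl; exact hsp hqp)

end InCone

/-! ### Entrances -/

theorem exists_max_of_bounded {P : V → Prop} {f : V → ℕ} {n : ℕ} (hn : ∀ a, P a → f a ≤ n)
    (h : ∃ a, P a) : ∃ a, P a ∧ ∀ b, P b → f b ≤ f a := by
  obtain ⟨a, ha⟩ := h
  have hbdd : BddAbove (f '' {a | P a}) := ⟨n, by rintro _ ⟨b, hb, rfl⟩; exact hn b hb⟩
  obtain ⟨m, hm, hm'⟩ := Nat.sSup_mem (s := f '' {a | P a}) ⟨f a, a, ha, rfl⟩ hbdd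
  exact ⟨m, hm, fun b hb => hm' ▸ le_csSup hbdd ⟨b, hb, rfl⟩⟩

/-- For `u` in a cone, the vertices of the panel `F(w)` in `I(w,u)` form a path starting at `w`;
any vertex of it farthest from `w` has all others on its geodesics to `w`. -/
theorem InCone.mem_interval_of_max (hc : G.Connected) (hbr : IsBridged G) (hK : G.CliqueFree 4)
    {z w b x u : V} (hu : InCone G z w b x u) {h : V} (hh : InPanel G z w h)
    (hhu : G.dist w h + G.dist h u = G.dist w u)
    (hmax : ∀ q, InPanel G z w q → G.dist w q + G.dist q u = G.dist w u →
      G.dist w q ≤ G.dist w h) :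
    ∀ (n : ℕ) (q : V), G.dist w q = n → InPanel G z w q →
      G.dist w q + G.dist q u = G.dist w u → G.dist w q + G.dist q h = G.dist w h := by
  have tri : ∀ a b c : V, G.dist a c ≤ G.dist a b + G.dist b c := fun a b c => hc.dist_triangle
  intro n
  induction n with
  | zero =>
    intro q hq _ _
    rw [← hc.dist_eq_zero_iff.mp hq, SimpleGraph.dist_self, Nat.zero_add]
  | succ n ih =>
    intro q hn hq hqu
    obtain ⟨r, hqr, hr⟩ := exists_adj_dist_add_one hc w (u := q) (by omega)
    have hrq1 : G.dist r q = 1 := SimpleGraph.dist_eq_one_iff_adj.mpr hqr.symm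
    have t1 := tri r q u
    have t2 := tri w r u
    have hru : G.dist w r + G.dist r u = G.dist w u := by omega
    have hrp : InPanel G z w r := hq.of_interval hc (by omega)
    have hrh := ih r (by omega) hrp hru
    have hqle := hmax q hq hqu
    obtain ⟨s, hrs, hs⟩ := exists_adj_dist_add_one hc h (u := r) (by rw [G.dist_comm]; omega)
    rw [G.dist_comm, G.dist_comm (u := h)] at hs
    have t3 := tri s h u
    have t4 := tri w s h
    have t5 := dist_le_add_one_of_adj hc w hrs
    have t6 := tri w s u
    have hsp : InPanel G z w s := hh.of_interval hc (by omega)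
    have hsq : s = q := hu.succ_unique hc hbr hK hrp hru hrs hqr.symm
      (by rw [G.dist_comm, G.dist_comm (u := u)]; omega)
      (by rw [G.dist_comm, G.dist_comm (u := u)]; omega) hsp hq
    subst hsq
    omega

/-- The entrance `h` of a vertex `u` of a cone on the boundary of a neighboring panel `F(w)` is the
last vertex of the path formed by the vertices of the panel in `I(w,u)`. -/
theorem InCone.entrance (hc : G.Connected) (hbr : IsBridged G) (hK : G.CliqueFree 4)
    {z w b x u h : V} (hu : InCone G z w b x u) (hw : OnBoundary G z w w)
    (hh : OnBoundary G z w h) (hmin : ∀ p, OnBoundary G z w p → G.dist u h ≤ G.dist u p)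
    (hclose : ∀ p, OnBoundary G z w p → (∀ q, OnBoundary G z w q → G.dist u p ≤ G.dist u q) →
      G.dist w h ≤ G.dist w p) :
    G.dist w h + G.dist h u = G.dist w u ∧ ∀ q, InPanel G z w q →
      G.dist w q + G.dist q u = G.dist w u → G.dist w q + G.dist q h = G.dist w h := by
  have tri : ∀ a b c : V, G.dist a c ≤ G.dist a b + G.dist b c := fun a b c => hc.dist_triangle
  obtain ⟨k, ⟨hk, hku⟩, hmax⟩ := exists_max_of_bounded
    (P := fun q => InPanel G z w q ∧ G.dist w q + G.dist q u = G.dist w u) (f := fun q => G.dist w q)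
    (n := G.dist w u) (fun a ha => by have := ha.2; omega)
    ⟨w, hw.1, by rw [SimpleGraph.dist_self, Nat.zero_add]⟩
  have hchain : ∀ q, InPanel G z w q → G.dist w q + G.dist q u = G.dist w u →
      G.dist w q + G.dist q k = G.dist w k := fun q hq hqu =>
    hu.mem_interval_of_max hc hbr hK hk hku (fun q h1 h2 => hmax q ⟨h1, h2⟩) _ q rfl hq hqu
  -- no boundary vertex is closer to `u` than `k`
  have hkmin : ∀ p, OnBoundary G z w p → G.dist u k ≤ G.dist u p := by
    intro p hp
    obtain ⟨g, ⟨hgk, hgp⟩, hgmax⟩ := exists_max_of_bounded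
      (P := fun q => G.dist w q + G.dist q k = G.dist w k ∧ G.dist w q + G.dist q p = G.dist w p)
      (f := fun q => G.dist w q) (n := G.dist w k) (fun a ha => by have := ha.1; omega)
      ⟨w, by rw [SimpleGraph.dist_self, Nat.zero_add], by rw [SimpleGraph.dist_self, Nat.zero_add]⟩
    have t1 := tri g k u
    have t2 := tri w g u
    have key : G.dist u g ≤ G.dist u p := by
      refine dist_le_of_no_common_neighbor hc hbr fun t hgt htu htp => ?_
      have t3 := tri w t u
      have t4 := tri w t p
      have t5 := dist_le_add_one_of_adj hc w hgt
      rw [G.dist_comm, G.dist_comm (v := g)] at htu htp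
      have htwp : G.dist w t + G.dist t p = G.dist w p := by omega
      have := hgmax t ⟨hchain t (hp.1.of_interval hc htwp) (by omega), htwp⟩
      omega
    have e1 := G.dist_comm (u := u) (v := g)
    have e2 := G.dist_comm (u := u) (v := k)
    omega
  have hkb := hu.onBoundary hc hbr hk hku
  have h1 := hclose k hkb hkmin
  have h2 := hmin k hkb
  have h3 := hkmin h hh
  have h4 := tri w h u
  have e1 := G.dist_comm (u := u) (v := h)
  have e2 := G.dist_comm (u := u) (v := k)
  have hhu : G.dist w h + G.dist h u = G.dist w u := by omega
  have h5 := hchain h hh.1 hhu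
  have hhk : h = k := hc.dist_eq_zero_iff.mp (by omega)
  subst hhk
  exact ⟨hhu, hchain⟩

/-! ### Two cones neighboring a common panel -/

theorem inPanel_self (hc : G.Connected) {z w : V} (h : G.Adj z w) : InPanel G z w w := by
  have h1 := SimpleGraph.dist_eq_one_iff_adj.mpr h
  refine ⟨⟨h, by rw [SimpleGraph.dist_self, h1]⟩, fun e he => hc.dist_eq_zero_iff.mp ?_⟩
  have := he.2
  omega

theorem onBoundary_self (hc : G.Connected) {z w : V} (h : G.Adj z w) : OnBoundary G z w w :=
  ⟨inPanel_self hc h, Or.inl rfl⟩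

/-- The entrances of `u` and `v` are the ends of the paths of panel vertices in `I(w,u)` and
`I(w,v)`. At the last common vertex `g` of these paths, the intervals `I(g,u)` and `I(g,v)` share no
neighbor of `g`, so that `d(u,v)` is at least `d(g,u)` and at least `d(g,v)`. -/
theorem exists_branching_vertex (hc : G.Connected) (hbr : IsBridged G) (hK : G.CliqueFree 4)
    {z w b c x y u v u' v' : V} (hu : InCone G z w b x u) (hv : InCone G z w c y v) (hxy : x ≠ y)
    (hu' : G.dist w u' + G.dist u' u = G.dist w u) (hv' : G.dist w v' + G.dist v' v = G.dist w v)
    (hu'max : ∀ q, InPanel G z w q → G.dist w q + G.dist q u = G.dist w u →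
      G.dist w q + G.dist q u' = G.dist w u')
    (hv'max : ∀ q, InPanel G z w q → G.dist w q + G.dist q v = G.dist w v →
      G.dist w q + G.dist q v' = G.dist w v') :
    ∃ g, G.dist w g + G.dist g u' = G.dist w u' ∧ G.dist w g + G.dist g v' = G.dist w v' ∧
      G.dist u u' + (G.dist g u' + G.dist g v') + G.dist v' v ≤ 2 * G.dist u v := by
  have tri : ∀ a b c : V, G.dist a c ≤ G.dist a b + G.dist b c := fun a b c => hc.dist_triangle
  obtain ⟨g, ⟨hgu, hgv⟩, hgmax⟩ := exists_max_of_bounded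
    (P := fun q => G.dist w q + G.dist q u' = G.dist w u' ∧ G.dist w q + G.dist q v' = G.dist w v')
    (f := fun q => G.dist w q) (n := G.dist w u') (fun a ha => by have := ha.1; omega)
    ⟨w, by rw [SimpleGraph.dist_self, Nat.zero_add], by rw [SimpleGraph.dist_self, Nat.zero_add]⟩
  have t1 := tri g u' u
  have t2 := tri w g u
  have t3 := tri g v' v
  have t4 := tri w g v
  have common : ∀ t, G.Adj g t → G.dist u t + 1 = G.dist u g → G.dist v t + 1 = G.dist v g →
      False := by
    intro t hgt htu htv
    have t5 := dist_le_add_one_of_adj hc w hgt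
    have t6 := tri w t u
    have t7 := tri w t v
    rw [G.dist_comm, G.dist_comm (v := g)] at htu htv
    have htwu : G.dist w t + G.dist t u = G.dist w u := by omega
    have htwv : G.dist w t + G.dist t v = G.dist w v := by omega
    have htw := hu.gate_left.dist_interval hc hu.gate_left.1 htwu
    have hzt := htw.2
    have hzu := hu.gate_left.2
    have hzv := hv.gate_left.2
    -- a second gate of `t` would be a gate of both `u` and `v`, and the two apexes would coincide
    have htp : InPanel G z w t := by
      refine ⟨htw, fun e he => ?_⟩
      by_contra hew
      have h1 := (hu.eq_or_eq hc hbr hK (he.mono hc (by omega))).resolve_left hew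
      have h2 := (hv.eq_or_eq hc hbr hK (he.mono hc (by omega))).resolve_left hew
      obtain ⟨s, hsw, hse, hs⟩ := exists_apex hc hbr htw he (Ne.symm hew)
      have hwe := (htw.eq_or_adj hc hbr he).resolve_left (Ne.symm hew)
      have key : ∀ {o k : V}, G.dist w t + G.dist t k = G.dist w k → G.Adj o w → G.Adj o e →
          G.dist o k + 1 = G.dist w k → s = o := by
        intro o k hk how hoe ho
        have t8 := tri s t k
        have t9 := dist_le_add_one_of_adj hc k hsw
        rw [G.dist_comm, G.dist_comm (u := k)] at t9
        exact apex_unique hc hbr hK hwe hsw hse (by omega) how hoe ho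
      exact hxy ((key htwu hu.adj_left (h1 ▸ hu.adj_right) hu.dist_add_one).symm.trans
        (key htwv hv.adj_left (h2 ▸ hv.adj_right) hv.dist_add_one))
    have := hgmax t ⟨hu'max t htp htwu, hv'max t htp htwv⟩
    omega
  have h1 := dist_le_of_no_common_neighbor hc hbr common
  have h2 := dist_le_of_no_common_neighbor hc hbr (fun t h3 h4 h5 => common t h3 h5 h4)
  refine ⟨g, hgu, hgv, ?_⟩
  have e1 := G.dist_comm (u := u) (v := u')
  have e2 := G.dist_comm (u := u) (v := g)
  have e3 := G.dist_comm (u := v) (v := g)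
  have e4 := G.dist_comm (u := v) (v := u)
  omega

/-- Two cones with the same gates `w`, `b` and different apexes: `w` is on a geodesic, because
otherwise the link of `w` would contain a short path between the apexes avoiding `b`. -/
theorem dist_add_of_same_gates (hc : G.Connected) (hbr : IsBridged G) (hK : G.CliqueFree 4)
    {z w b x y u v : V} (hu : InCone G z w b x u) (hv : InCone G z w b y v) (hxy : x ≠ y)
    (hxy' : ¬ G.Adj x y) : G.dist u w + G.dist w v = G.dist u v := by
  by_contra hne
  have t1 := hc.dist_triangle (u := u) (v := w) (w := v)
  have hu0 := hu.dist_add_one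
  have hv0 := hv.dist_add_one
  have hub := hu.gate_right.2
  have huw := hu.gate_left.2
  have hvb := hv.gate_right.2
  have hvw := hv.gate_left.2
  simp only [G.dist_comm (u := w), G.dist_comm (u := b), G.dist_comm (u := z), G.dist_comm (u := x),
    G.dist_comm (u := y)] at hu0 hv0 hub huw hvb hvw t1 hne
  obtain ⟨s, t, hws, hwt, hs, ht, hst⟩ := exists_adj_of_dist_lt hc hbr (p := u) (q := v) (u := w)
    (by omega) (by omega) (by omega)
  have hwb := hu.adj_gates hc hbr
  have hsb : s ≠ b := by rintro rfl; omega
  have htb : t ≠ b := by rintro rfl; omega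
  have nb : ∀ {o r : V}, G.Adj o w → G.Adj o b → G.Adj w r → G.Adj o r → ¬ G.Adj b r :=
    fun how hob hwr hor hbr' => not_k4 hK how hob hor hwb hwr hbr'
  have one : ∀ r, r ≠ b → G.Adj w r → G.Adj x r → G.Adj y r → False := by
    intro r hrb hwr hxr hyr
    rcases square_has_diagonal hc hbr hxr hyr.symm hv.adj_right hu.adj_right.symm hxy hrb with h | h
    · exact hxy' h
    · exact nb hu.adj_left hu.adj_right hwr hxr h.symm
  have hxs := adj_of_mem_interval hc hbr hu.adj_left.symm hws hu0 hs
  have hyt := adj_of_mem_interval hc hbr hv.adj_left.symm hwt hv0 ht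
  rcases hxs with rfl | hxs
  · rcases hyt with rfl | hyt
    · exact hst.elim hxy hxy'
    · rcases hst with rfl | hst
      · exact hxy' hyt.symm
      · exact one t htb hwt hst hyt
  rcases hyt with rfl | hyt
  · rcases hst with rfl | hst
    · exact hxy' hxs
    · exact one s hsb hws hxs hst.symm
  rcases hst with rfl | hst
  · exact one s hsb hws hxs hyt
  exact not_induced_pentagon hc hbr hu.adj_right.symm hxs hst hyt.symm hv.adj_right
    (nb hu.adj_left hu.adj_right hws hxs) (fun h => one t htb hwt h hyt)
    (fun h => one s hsb hws hxs h.symm)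
    (fun h => nb hv.adj_left hv.adj_right hwt hyt h.symm) (fun h => hxy' h.symm)

/-- A geodesic between vertices of two cones with apexes at distance 2 and a common gate `w` can be
chosen to meet the panel `F(w)`. If the other gates `b` and `c` are different, a geodesic avoiding
`F(w)` has at each vertex a gate adjacent to `w`, since the link of `z` has no short cycles; this
gate is unique and does not change along the geodesic, so that it equals both `b` and `c`. -/
theorem exists_inPanel_mem_interval (hc : G.Connected) (hbr : IsBridged G) (hK : G.CliqueFree 4)
    {z w b c x y u v : V} (hu : InCone G z w b x u) (hv : InCone G z w c y v) (hxy : x ≠ y)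
    (hxy' : ¬ G.Adj x y) : ∃ t, InPanel G z w t ∧ G.dist u t + G.dist t v = G.dist u v := by
  have hzw := hu.gate_left.1
  by_cases hbc : b = c
  · subst hbc
    exact ⟨w, inPanel_self hc hzw, dist_add_of_same_gates hc hbr hK hu hv hxy hxy'⟩
  have tri : ∀ a b c : V, G.dist a c ≤ G.dist a b + G.dist b c := fun a b c => hc.dist_triangle
  by_contra hno
  push Not at hno
  have hwb := hu.adj_gates hc hbr
  have hwc := hv.adj_gates hc hbr
  have hzb := hu.gate_right.1
  have hzc := hv.gate_right.1
  have nbc : ¬ G.Adj b c := fun h => not_k4 hK hzw hzb hzc hwb hwc h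
  have huw := hu.gate_left.2
  have hvw := hv.gate_left.2
  have huv := tri u w v
  rw [G.dist_comm (u := u) (v := w)] at huv
  have around : ∀ {t k : V}, G.dist u t + G.dist t v = G.dist u v → 0 < G.dist z k →
      G.dist t k < G.dist z t + G.dist z k →
      ∃ e e', IsGate G z t e ∧ IsGate G z k e' ∧ (e = e' ∨ G.Adj e e') := by
    intro t k ht hk htk
    have h1 := tri u z v
    have h2 := G.dist_comm (u := u) (v := z)
    have htz : 0 < G.dist t z := by
      refine hc.pos_dist_of_ne ?_
      rintro rfl
      omega
    obtain ⟨e, e', he, he', hte, hke, hee⟩ := exists_adj_of_dist_lt hc hbr (p := t) (q := k)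
      (u := z) htz (by rwa [G.dist_comm])
      (by rwa [G.dist_comm (u := t) (v := z), G.dist_comm (u := k) (v := z)])
    rw [G.dist_comm, G.dist_comm (v := z)] at hte hke
    exact ⟨e, e', ⟨he, hte⟩, ⟨he', hke⟩, hee⟩
  have near : ∀ {t : V}, G.dist u t + G.dist t v = G.dist u v →
      ∃ f, IsGate G z t f ∧ (f = w ∨ G.Adj f w) := by
    intro t ht
    have h1 := tri z t u
    have h2 := tri z t v
    have h3 := G.dist_comm (u := u) (v := t)
    obtain ⟨e, k, he, hk, hek⟩ := around ht hu.gate_left.pos (by omega)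
    obtain ⟨f, l, hf, hl, hfl⟩ := around ht hv.gate_left.pos (by omega)
    by_contra hfar
    push Not at hfar
    -- `e` and `f` would close a 4-cycle or an induced 5-cycle through `b`, `w`, `c` in the link of `z`
    have heb : G.Adj e b := by
      rcases hu.eq_or_eq hc hbr hK hk with rfl | rfl
      · rcases hek with rfl | hek
        · exact absurd rfl (hfar _ he).1
        · exact absurd hek (hfar _ he).2
      · rcases hek with rfl | hek
        · exact absurd hwb.symm (hfar _ he).2
        · exact hek
    have hfc : G.Adj f c := by
      rcases hv.eq_or_eq hc hbr hK hl with rfl | rfl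
      · rcases hfl with rfl | hfl
        · exact absurd rfl (hfar _ hf).1
        · exact absurd hfl (hfar _ hf).2
      · rcases hfl with rfl | hfl
        · exact absurd hwc.symm (hfar _ hf).2
        · exact hfl
    rcases he.eq_or_adj hc hbr hf with rfl | hef
    · rcases square_has_diagonal hc hbr hwb heb.symm hfc hwc.symm (hfar _ he).1.symm hbc with h | h
      · exact (hfar _ he).2 h.symm
      · exact nbc h
    · exact not_induced_pentagon hc hbr hwb heb.symm hef hfc hwc.symm
        (fun h => (hfar _ he).2 h.symm) (fun h => not_k4 hK hzb he.1 hf.1 heb.symm h hef)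
        (fun h => not_k4 hK hzc he.1 hf.1 h.symm hfc.symm hef) (fun h => (hfar _ hf).2 h)
        (fun h => nbc h.symm)
  -- the gate adjacent to `w` is the same along the whole geodesic
  have const : ∀ (n : ℕ) (t : V), G.dist u t = n → G.dist u t + G.dist t v = G.dist u v →
      IsGate G z t b := by
    intro n
    induction n with
    | zero =>
      intro t ht _
      rw [← hc.dist_eq_zero_iff.mp ht]
      exact hu.gate_right
    | succ n ih =>
      intro t hn ht
      obtain ⟨s, hts, hs⟩ := exists_adj_dist_add_one hc u (u := t) (by omega)
      have h1 := tri s t v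
      rw [SimpleGraph.dist_eq_one_iff_adj.mpr hts.symm] at h1
      have h2 := tri u s v
      have hsb := ih s (by omega) (by omega)
      obtain ⟨f, hf, hfw⟩ : ∃ f, IsGate G z t f ∧ G.Adj f w := by
        obtain ⟨f, hf, rfl | hfw⟩ := near ht
        · by_contra hall
          push Not at hall
          refine hno t ⟨hf, fun e he => ?_⟩ ht
          by_contra hef
          exact hall e he ((he.eq_or_adj hc hbr hf).resolve_left hef)
        · exact ⟨f, hf, hfw⟩
      have nbf : ¬ G.Adj b f := fun h => not_k4 hK hzw hzb hf.1 hwb hfw.symm h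
      by_cases hone : G.dist z s = 1 ∧ G.dist z t = 1
      · have h3 := hsb.2
        have h4 := hf.2
        have h5 : b = s := hc.dist_eq_zero_iff.mp (by omega)
        have h6 : f = t := hc.dist_eq_zero_iff.mp (by omega)
        exact absurd (h5 ▸ h6 ▸ hts.symm) nbf
      · rcases isGate_nested hc hbr hK hts.symm hone with h | h
        · exact h b hsb
        · rcases hsb.eq_or_adj hc hbr (h f hf) with rfl | h'
          · exact hf
          · exact absurd h' nbf
  rcases hv.eq_or_eq hc hbr hK (const _ v rfl (by rw [SimpleGraph.dist_self, Nat.add_zero])) with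
    h | h
  · exact hu.ne h
  · exact hbc h

/-! ### Fibers and boundaries in terms of gates -/

theorem metricProj_closedNbhd (hc : G.Connected) {z u : V} (h : u ≠ z) :
    metricProj G u (closedNbhd G z) = {e | IsGate G z u e} := by
  obtain ⟨e, he⟩ := exists_isGate hc h
  have he2 := he.2
  ext t
  simp only [metricProj, closedNbhd, Set.mem_ofPred_eq, IsGate]
  constructor
  · rintro ⟨ht, hmin⟩
    have h1 := hmin e (Or.inr he.1)
    rw [G.dist_comm, G.dist_comm (u := u)] at h1
    rcases ht with rfl | ht
    · omega
    · have h2 := dist_le_add_one_of_adj hc u ht.symm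
      rw [G.dist_comm, G.dist_comm (u := u)] at h2
      exact ⟨ht, by omega⟩
  · rintro ⟨ht, htu⟩
    refine ⟨Or.inr ht, ?_⟩
    rintro a (rfl | ha)
    · rw [G.dist_comm, G.dist_comm (u := u)]
      omega
    · have h2 := dist_le_add_one_of_adj hc u ha.symm
      rw [G.dist_comm, G.dist_comm (u := u)] at h2
      rw [G.dist_comm, G.dist_comm (u := u)]
      omega

theorem metricProj_closedNbhd_self (hc : G.Connected) (z : V) :
    metricProj G z (closedNbhd G z) = {z} := by
  ext t
  simp only [metricProj, closedNbhd, Set.mem_ofPred_eq, Set.mem_singleton_iff]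
  constructor
  · rintro ⟨-, hmin⟩
    have := hmin z (Or.inl rfl)
    rw [SimpleGraph.dist_self] at this
    exact (hc.dist_eq_zero_iff.mp (by omega)).symm
  · rintro rfl
    exact ⟨Or.inl rfl, fun a _ => by rw [SimpleGraph.dist_self]; omega⟩

theorem mem_fiber_iff_inPanel (hc : G.Connected) {z w u : V} (hzw : G.Adj z w) :
    u ∈ fiber G z w ↔ InPanel G z w u := by
  have hw : w ∈ closedNbhd G z := Or.inr hzw
  simp only [fiber, Set.mem_ofPred_eq, hw, true_and, not_true, false_and, or_false]
  by_cases huz : u = z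
  · subst huz
    rw [metricProj_closedNbhd_self hc]
    constructor
    · intro h
      exact absurd (Set.singleton_eq_singleton_iff.mp h) hzw.ne
    · intro h
      have := h.1.pos
      rw [SimpleGraph.dist_self] at this
      omega
  · rw [metricProj_closedNbhd hc huz, Set.eq_singleton_iff_unique_mem]
    rfl

theorem inCone_of_mem_fiber (hc : G.Connected) (hbr : IsBridged G) (hK : G.CliqueFree 4)
    {z w x u : V} (hzw : G.Adj z w) (hwx : G.Adj w x) (hxz : G.dist x z = 2)
    (hu : u ∈ fiber G z x) : ∃ b, InCone G z w b x u := by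
  have hx : x ∉ closedNbhd G z := by
    rintro (rfl | h)
    · rw [SimpleGraph.dist_self] at hxz
      omega
    · rw [G.dist_comm, SimpleGraph.dist_eq_one_iff_adj.mpr h] at hxz
      omega
  simp only [fiber, Set.mem_ofPred_eq, hx, false_and, not_false_eq_true, true_and, false_or] at hu
  obtain ⟨a, b, hab, hproj, hxa, hxb, ha, hb⟩ := hu
  have huz : u ≠ z := by
    rintro rfl
    rw [metricProj_closedNbhd_self hc] at hproj
    have h1 : a ∈ ({u} : Set V) := hproj ▸ Set.mem_insert _ _
    have h2 : b ∈ ({u} : Set V) := hproj ▸ Set.mem_insert_of_mem _ rfl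
    exact hab.ne (h1.trans h2.symm)
  rw [metricProj_closedNbhd hc huz] at hproj
  have hga : IsGate G z u a := by
    have : a ∈ {e | IsGate G z u e} := hproj ▸ Set.mem_insert _ _
    exact this
  have hgb : IsGate G z u b := by
    have : b ∈ {e | IsGate G z u e} := hproj ▸ Set.mem_insert_of_mem _ rfl
    exact this
  have gx : ∀ {e : V}, G.Adj z e → G.Adj e x → IsGate G z x e := by
    intro e h1 h2
    refine ⟨h1, ?_⟩
    rw [SimpleGraph.dist_eq_one_iff_adj.mpr h2, G.dist_comm, hxz]
  rcases (gx hga.1 hxa.symm).eq_or_eq hc hbr hK (gx hgb.1 hxb.symm) hab.ne (gx hzw hwx)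
    with rfl | rfl
  · exact ⟨b, hga, hgb, hab.ne', hxa, hxb, by rw [G.dist_comm, ha, G.dist_comm]⟩
  · exact ⟨a, hgb, hga, hab.ne, hxb, hxa, by rw [G.dist_comm, hb, G.dist_comm]⟩

theorem mem_totalBoundary_iff (hc : G.Connected) (hbr : IsBridged G) (hK : G.CliqueFree 4)
    {z w p : V} (hzw : G.Adj z w) : p ∈ totalBoundary G z w ↔ OnBoundary G z w p := by
  constructor
  · rintro ⟨y, -, hyw, hp, t, ht, hpt⟩
    rw [mem_fiber_iff_inPanel hc hzw] at hp
    refine ⟨hp, ?_⟩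
    by_cases hpw : p = w
    · exact Or.inl hpw
    have hlev : G.dist z p ≠ 1 := by
      intro h
      refine hpw (hp.2 p ⟨SimpleGraph.dist_eq_one_iff_adj.mp h, ?_⟩)
      rw [SimpleGraph.dist_self, h]
    have htz : t ≠ z := by
      rintro rfl
      exact hlev (SimpleGraph.dist_eq_one_iff_adj.mpr hpt.symm)
    have htp : ¬ InPanel G z w t := by
      intro h
      have hproj := metricProj_closedNbhd hc htz
      have hset : {e | IsGate G z t e} = {w} := Set.eq_singleton_iff_unique_mem.mpr h
      rw [hset] at hproj
      rcases ht with ⟨-, h'⟩ | ⟨-, a, b, hab, h', -⟩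
      · rw [hproj] at h'
        exact hyw (Set.singleton_eq_singleton_iff.mp h').symm
      · rw [hproj] at h'
        have h1 : a ∈ ({w} : Set V) := h' ▸ Set.mem_insert _ _
        have h2 : b ∈ ({w} : Set V) := h' ▸ Set.mem_insert_of_mem _ rfl
        exact hab.ne (h1.trans h2.symm)
    right
    rcases isGate_nested hc hbr hK hpt (fun h => hlev h.1) with h | h
    · have htw := h w hp.1
      by_contra hno
      push Not at hno
      exact htp ⟨htw, fun e he => hno t e hpt htw he⟩
    · obtain ⟨e, he⟩ := exists_isGate hc htz
      have hew := hp.2 e (h e he)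
      exact absurd ⟨hew ▸ he, fun e' he' => hp.2 e' (h e' he')⟩ htp
  · rintro ⟨hp, rfl | ⟨t, e, hpt, htw, hte, hew⟩⟩
    · exact ⟨z, Or.inl (Or.inl rfl), hzw.ne, (mem_fiber_iff_inPanel hc hzw).mpr hp, z,
        Or.inl ⟨Or.inl rfl, metricProj_closedNbhd_self hc z⟩, hzw.symm⟩
    · obtain ⟨x, hxw, hxe, hx⟩ := exists_apex hc hbr htw hte hew.symm
      have h1 := htw.2
      have h2 := hte.2
      have h3 := hc.dist_triangle (u := z) (v := x) (w := t)
      have hxn : x ∉ closedNbhd G z := by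
        rintro (rfl | h)
        · omega
        · rw [SimpleGraph.dist_eq_one_iff_adj.mpr h] at h3
          omega
      have htz : t ≠ z := by
        rintro rfl
        rw [SimpleGraph.dist_self] at h1
        omega
      refine ⟨x, Or.inr ⟨hxn, w, Or.inr hzw, e, Or.inr hte.1, hew.symm, hxw, hxe⟩, hxw.ne,
        (mem_fiber_iff_inPanel hc hzw).mpr hp, t, Or.inr ⟨hxn, w, e,
          (htw.eq_or_adj hc hbr hte).resolve_left hew.symm, ?_, hxw, hxe, ?_, ?_⟩, hpt⟩
      · rw [metricProj_closedNbhd hc htz]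
        ext f
        simp only [Set.mem_ofPred_eq, Set.mem_insert_iff, Set.mem_singleton_iff]
        constructor
        · exact fun hf => htw.eq_or_eq hc hbr hK hte hew.symm hf
        · rintro (rfl | rfl) <;> assumption
      · rw [G.dist_comm, hx, G.dist_comm]
      · rw [G.dist_comm, G.dist_comm (u := t)]
        omega

/-! ### The starshaped tree -/

theorem inducedOn_adj {A : Set V} {a b : V} :
    (inducedOn G A).Adj a b ↔ a ∈ A ∧ b ∈ A ∧ G.Adj a b := by
  simp [inducedOn]
  tauto

theorem branchGraph_adj {w : V} {T : Set V} {a b : V} :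
    (branchGraph G w T).Adj a b ↔
      ∃ s ∈ T, a ∈ interval G w s ∧ b ∈ interval G w s ∧ G.Adj a b := by
  simp only [branchGraph, SimpleGraph.iSup_adj, inducedOn_adj, exists_prop]

/-- Within a branch of the starshaped tree, distances are at most those of `G`. -/
theorem edist_branchGraph_le (hc : G.Connected) {w s : V} {T : Set V} (hs : s ∈ T) :
    ∀ (n : ℕ) (q : V), G.dist q s = n → q ∈ interval G w s →
      (branchGraph G w T).edist q s ≤ (n : ℕ∞) := by
  intro n
  induction n with
  | zero =>
    intro q hq _
    rw [hc.dist_eq_zero_iff.mp hq, SimpleGraph.edist_self]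
    exact zero_le
  | succ n ih =>
    intro q hq hqs
    have hqs' : G.dist w q + G.dist q s = G.dist w s := hqs
    obtain ⟨r, hqr, hr⟩ := exists_adj_dist_add_one hc s (u := q) (by rw [G.dist_comm]; omega)
    rw [G.dist_comm, G.dist_comm (v := q)] at hr
    have h1 := dist_le_add_one_of_adj hc w hqr
    have h2 := hc.dist_triangle (u := w) (v := r) (w := s)
    have hrs : r ∈ interval G w s := by
      change G.dist w r + G.dist r s = G.dist w s
      omega
    have hadj : (branchGraph G w T).Adj q r := branchGraph_adj.mpr ⟨s, hs, hqs, hrs, hqr⟩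
    refine (SimpleGraph.edist_triangle (v := r)).trans ?_
    rw [SimpleGraph.edist_eq_one_iff_adj.mpr hadj, add_comm, Nat.cast_add, Nat.cast_one]
    gcongr
    exact ih r (by omega) hrs

end BridgedStar

theorem mainTheorem3 {V : Type*} [Finite V] (G : SimpleGraph V) (hconn : G.Connected)
    (hK4 : G.CliqueFree 4) (hbr : BridgedStar.IsBridged G)
    (z x y w u v u' v' : V)
    (hx : BridgedStar.IsCone G z x) (hy : BridgedStar.IsCone G z y)
    (hxy : BridgedStar.Neighboring G z 2 x y)
    (hw : BridgedStar.IsPanel G z w)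
    (hwx : BridgedStar.Neighboring G z 1 w x) (hwy : BridgedStar.Neighboring G z 1 w y)
    (hu : u ∈ BridgedStar.fiber G z x) (hv : v ∈ BridgedStar.fiber G z y)
    (hu' : BridgedStar.IsEntrance G z w u u') (hv' : BridgedStar.IsEntrance G z w v v') :
    (∃ p : G.Walk u v, p.length = G.dist u v ∧ ∃ t ∈ p.support, t ∈ BridgedStar.fiber G z w) ∧
    (G.dist u v : ℕ∞) ≤
      G.dist u u' +
        (BridgedStar.inducedOn G (BridgedStar.totalBoundary G z w)).edist u' v' + G.dist v' v ∧
    (G.dist u u' : ℕ∞) +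
        (BridgedStar.inducedOn G (BridgedStar.totalBoundary G z w)).edist u' v' + G.dist v' v ≤
      G.dist u u' +
        (BridgedStar.branchGraph G w (BridgedStar.totalBoundary G z w)).edist u' v' +
          G.dist v' v ∧
    (G.dist u u' : ℕ∞) +
        (BridgedStar.branchGraph G w (BridgedStar.totalBoundary G z w)).edist u' v' +
          G.dist v' v ≤
      4 * G.dist u v := by
  have hzw : G.Adj z w := hw.2.symm
  have hwx' : G.Adj w x :=
    (BridgedStar.inducedOn_adj.mp (SimpleGraph.edist_eq_one_iff_adj.mp hwx.2.2)).2.2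
  have hwy' : G.Adj w y :=
    (BridgedStar.inducedOn_adj.mp (SimpleGraph.edist_eq_one_iff_adj.mp hwy.2.2)).2.2
  have hne : x ≠ y := by
    rintro rfl
    have := hxy.2.2
    rw [SimpleGraph.edist_self] at this
    norm_num at this
  have hnadj : ¬ G.Adj x y := by
    intro h
    have h1 := hxy.2.2
    rw [SimpleGraph.edist_eq_one_iff_adj.mpr
      (BridgedStar.inducedOn_adj.mpr ⟨hxy.1, hxy.2.1, h⟩)] at h1
    norm_num at h1
  obtain ⟨b, hub⟩ := BridgedStar.inCone_of_mem_fiber hconn hbr hK4 hzw hwx' hx.2 hu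
  obtain ⟨c, hvc⟩ := BridgedStar.inCone_of_mem_fiber hconn hbr hK4 hzw hwy' hy.2 hv
  have hT : ∀ {p : V}, p ∈ BridgedStar.totalBoundary G z w ↔ BridgedStar.OnBoundary G z w p :=
    BridgedStar.mem_totalBoundary_iff hconn hbr hK4 hzw
  have ent : ∀ {x b u u' : V}, BridgedStar.InCone G z w b x u →
      BridgedStar.IsEntrance G z w u u' → _ := fun {x b u u'} hu hu' =>
    hu.entrance hconn hbr hK4 (h := u') (BridgedStar.onBoundary_self hconn hzw) (hT.mp hu'.1.1)
      (fun p hp => hu'.1.2 p (hT.mpr hp)) (fun p hp hmin => by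
        have := hu'.2 p ⟨hT.mpr hp, fun q hq => hmin q (hT.mp hq)⟩
        rwa [G.dist_comm, G.dist_comm (u := p)] at this)
  refine ⟨?_, ?_, ?_, ?_⟩
  · obtain ⟨t, ht, htuv⟩ :=
      BridgedStar.exists_inPanel_mem_interval hconn hbr hK4 hub hvc hne hnadj
    obtain ⟨p, hp⟩ := hconn.exists_walk_length_eq_dist u t
    obtain ⟨q, hq⟩ := hconn.exists_walk_length_eq_dist t v
    refine ⟨p.append q, by rw [SimpleGraph.Walk.length_append, hp, hq, htuv], t, ?_,
      (BridgedStar.mem_fiber_iff_inPanel hconn hzw).mpr ht⟩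
    exact SimpleGraph.Walk.mem_support_append_iff p q |>.mpr (Or.inl p.end_mem_support)
  · have hle : BridgedStar.inducedOn G (BridgedStar.totalBoundary G z w) ≤ G :=
      fun a b h => (BridgedStar.inducedOn_adj.mp h).2.2
    have hdist : ∀ a b : V, (G.dist a b : ℕ∞) = G.edist a b :=
      fun a b => (hconn.preconnected a b).coe_dist_eq_edist
    rw [hdist, hdist, hdist]
    refine (SimpleGraph.edist_triangle (v := v')).trans ?_
    gcongr
    refine (SimpleGraph.edist_triangle (v := u')).trans ?_
    gcongr
  · gcongr
    intro a b h
    obtain ⟨s, hs, ha, hb, hab⟩ := BridgedStar.branchGraph_adj.mp h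
    exact BridgedStar.inducedOn_adj.mpr
      ⟨hT.mpr ((hT.mp hs).of_interval hconn hbr hK4 _ s rfl ha),
        hT.mpr ((hT.mp hs).of_interval hconn hbr hK4 _ s rfl hb), hab⟩
  · obtain ⟨hu1, hu2⟩ := ent hub hu'
    obtain ⟨hv1, hv2⟩ := ent hvc hv'
    obtain ⟨g, hgu, hgv, hg⟩ :=
      BridgedStar.exists_branching_vertex hconn hbr hK4 hub hvc hne hu1 hv1 hu2 hv2
    have h1 := BridgedStar.edist_branchGraph_le hconn hu'.1.1 _ g rfl hgu
    have h2 := BridgedStar.edist_branchGraph_le hconn hv'.1.1 _ g rfl hgv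
    rw [SimpleGraph.edist_comm] at h1
    calc (G.dist u u' : ℕ∞) +
          (BridgedStar.branchGraph G w (BridgedStar.totalBoundary G z w)).edist u' v' +
            G.dist v' v
        ≤ G.dist u u' + (G.dist g u' + G.dist g v') + G.dist v' v := by
          gcongr
          exact (SimpleGraph.edist_triangle (v := g)).trans (add_le_add h1 h2)
      _ ≤ 2 * G.dist u v := by exact_mod_cast hg
      _ ≤ 4 * G.dist u v := by gcongr; norm_num
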